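/- Let $\nu,r,d\in\mathbb N$ with $\nu\ge1$ and $1\le r\le d$, and let $\Gamma_+\subset\Gamma$ be the sets of combinations $j=\sum_{k=1}^r j_k\mathbf w_k$ with coefficients $j_k\in\mathbb N$, respectively $j_k\in\mathbb Z$, of linearly independent vectors $\mathbf w_1,\dots,\mathbf w_r\in\mathbb R^r$. Put $\mathfrak N=\mathbb Z^\nu\times\Gamma_+$ and, for $\mathfrak n=(l,j)\in\mathbb Z^\nu\times\Gamma$, $|\mathfrak n|=\max\{|l_1|,\dots,|l_\nu|,|j_1|,\dots,|j_r|\}$ and $\langle\mathfrak n\rangle=\max\{1,|\mathfrak n|\}$. Diameters and distances in $\mathfrak N$ are taken with respect to $|\mathfrak n-\mathfrak n'|$ (distance to the empty set being $+\infty$). Fix integers $\mathfrak d_j\ge1$ ($j\in\Gamma_+$). For finite $\mathfrak B,\mathfrak C\subset\mathfrak N$ let $\mathcal M^{\mathfrak B}_{\mathfrak C}$ be the space of block matrices $M=(M_{\mathfrak n'}^{\mathfrak n''})_{\mathfrak n'\in\mathfrak C,\,\mathfrak n''\in\mathfrak B}$ with $M_{\mathfrak n'}^{\mathfrak n''}\in\mathbb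 C^{\mathfrak d_{j'}\times\mathfrak d_{j''}}$ for $\mathfrak n'=(l',j')$, $\mathfrak n''=(l'',j'')$; let $\|\cdot\|_0$ be the $\ell^2$ operator norm (of matrices and of blocks), and $$|M|_s^2=K_0\sum_{\mathfrak n\in\mathbb Z^\nu\times\Gamma}[M(\mathfrak n)]^2\langle\mathfrak n\rangle^{2s},\qquad [M(\mathfrak n)]=\sup_{\mathfrak n'\in\mathfrak C,\ \mathfrak n''\in\mathfrak B,\ \mathfrak n'-\mathfrak n''=\mathfrak n}\|M_{\mathfrak n'}^{\mathfrak n''}\|_0$$ (with $[M(\mathfrak n)]=0$ if $\mathfrak n\notin\mathfrak C-\mathfrak B$), where $s_0>(\nu+d)/2$ and $K_0>4\sum_{\mathfrak n\in\mathbb Z^\nu\times\Gamma}\langle\mathfrak n\rangle^{-2s_0}$ are fixed. Let $\varrho=(2\nu+d+r+1)/2$, $\tau>0$, $\mathfrak e=\tau_2+\nu+r+s_0$, and assume $$\delta\in(0,1/2),\quad \tau_2>2\tau+\nu+r+1,\quad C_1\ge2,\quad \chi_0(\tau_2-2\tau-\nu-r)>3(\mathfrak e+C_1(s_0+\nu+r)),\quad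 \chi_0\delta>C_1,$$ $$3\mathfrak e+2\chi_0(\tau+\nu+r)+C_1s_0<s_1-\varrho .$$ Definitions. For real $N>0$, a matrix $\mathcal A\in\mathcal M^{\mathfrak F}_{\mathfrak F}$ with $\mathrm{diam}(\mathfrak F)\le4N$ is *$N$-good* if it is invertible with $|\mathcal A^{-1}|_s\le N^{\tau_2+\delta s}$ for all $s\in[s_0,s_1-\varrho]$. Let $\mathcal A\in\mathcal M^{\mathfrak A}_{\mathfrak A}$ have scalar diagonal blocks $\mathcal A_{\mathfrak n}^{\mathfrak n}=\tilde\mu_{\mathfrak n}I$, $\tilde\mu_{\mathfrak n}\in\mathbb C$. Given $\tilde\Theta>0$, a site $\mathfrak n\in\mathfrak A$ is *$(\mathcal A,N)$-good* if either $|\tilde\mu_{\mathfrak n}|\ge\tilde\Theta$, or there is $\mathfrak F\subset\mathfrak A$ with $\mathrm{diam}(\mathfrak F)\le4N$ and $\mathrm d(\mathfrak n,\mathfrak A\setminus\mathfrak F)\ge N$ such that $\mathcal A^{\mathfrak F}_{\mathfrak F}$ is $N$-good; otherwise it is *$(\mathcal A,N)$-bad*. Let $\mathcal Q=\mathcal A-\mathrm{Diag}(\mathcal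 A)$ be $\mathcal A$ with its diagonal blocks removed. Claim. For every $\Upsilon>0$ there is $\Theta_0=\Theta_0(\Upsilon,s_1)>0$ such that for every $\tilde\Theta\ge\Theta_0$ and every $s_2\ge s_1-\varrho$ there is $\bar N=\bar N(\Upsilon,\tilde\Theta,s_2)\in\mathbb N$ with the following property ($\Theta_0$ and $\bar N$ may also depend on the data and parameters fixed above, but not on the objects quantified next). Let $N\ge\bar N$, $\chi\in[\chi_0,2\chi_0]$, $N'=N^\chi$, let $\mathfrak A\subset\mathfrak N$ with $\mathrm{diam}(\mathfrak A)\le4N'$, and let $\mathcal A\in\mathcal M^{\mathfrak A}_{\mathfrak A}$ have scalar diagonal blocks and satisfy (A1) $|\mathcal Q|_{s_1-\varrho}\le\Upsilon$; (A2) $\mathcal A$ is invertible and $\|\mathcal A^{-1}\|_0\le(N')^\tau$; (A3) the set of $(\mathcal A,N)$-bad sites of $\mathfrak A$ has a partition into clusters $\mathfrak O_\alpha$ with $\mathrm{diam}(\mathfrak O_\alpha)\le N^{C_1}$ and $\mathrm d(\mathfrak O_\alpha,\mathfrak O_\beta)\ge N^2$ for all $\alpha\ne\beta$. Then $\mathcal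 A$ is $N'$-good and $$|\mathcal A^{-1}|_s\le\tfrac14(N')^{\tau_2}\big((N')^{\delta s}+|\mathcal Q|_s\big)\qquad\text{for all }s\in[s_0,s_2].$$ -/

import Mathlib

/-- Sites `𝔫 = (l, j)` of the index set `𝔑 = ℤ^ν × Γ₊`.  An element `j = ∑ j_k w_k` of `Γ₊`
(`w_1, …, w_r` linearly independent, `j_k ∈ ℕ`) is given by its coordinates `(j_1, …, j_r)`. -/
abbrev Site (ν r : ℕ) : Type := (Fin ν → ℤ) × (Fin r → ℕ)

/-- The lattice `ℤ^ν × Γ` containing the differences of sites, in coordinates.  Its Mathlib norm is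
the maximum of the absolute values of all coordinates, i.e. `|𝔫| = max {|l|, |j|}`. -/
abbrev LatticePt (ν r : ℕ) : Type := (Fin ν → ℤ) × (Fin r → ℤ)

namespace Multiscale

variable {ν r : ℕ}

/-- The difference `𝔫 - 𝔫'`, in `ℤ^ν × Γ`. -/
def siteSub (n n' : Site ν r) : LatticePt ν r :=
  (n.1 - n'.1, fun k => (n.2 k : ℤ) - (n'.2 k : ℤ))

/-- The distance `|𝔫 - 𝔫'|` of two sites. -/
noncomputable def siteDist (n n' : Site ν r) : ℝ := ‖siteSub n n'‖

/-- `diam 𝔈 ≤ R`. -/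
def DiamLE (E : Finset (Site ν r)) (R : ℝ) : Prop :=
  ∀ n ∈ E, ∀ n' ∈ E, siteDist n n' ≤ R

/-- `d(𝔘₁, 𝔘₂) ≥ R` (the infimum over an empty set being `+∞`). -/
def DistGE (U₁ U₂ : Finset (Site ν r)) (R : ℝ) : Prop :=
  ∀ n ∈ U₁, ∀ n' ∈ U₂, R ≤ siteDist n n'

/-- The weight `⟨k⟩ = max (1, |k|)`. -/
noncomputable def bracket (k : LatticePt ν r) : ℝ := max 1 ‖k‖

/-- The scalar basis indices over `𝔅`: pairs of a site `(l, j) ∈ 𝔅` and `p ∈ {1, …, 𝔡_j}`. -/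
abbrev BlockIdx (dim : (Fin r → ℕ) → ℕ) (B : Finset (Site ν r)) : Type :=
  (n : {n // n ∈ B}) × Fin (dim n.1.2)

/-- The space `𝓜^𝔅_ℭ` of complex block matrices with rows indexed by `ℭ`, columns by `𝔅`, and
blocks `M_{𝔫'}^{𝔫''}` of size `𝔡_{j'} × 𝔡_{j''}`. -/
abbrev BlockMat (dim : (Fin r → ℕ) → ℕ) (C B : Finset (Site ν r)) : Type :=
  Matrix (BlockIdx dim C) (BlockIdx dim B) ℂ

open scoped Matrix.Norms.L2Operator in
/-- The `L²` operator norm `‖M‖₀` of a complex matrix. -/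
noncomputable def opNorm {m n : Type*} [Fintype m] [Fintype n] [DecidableEq n]
    (M : Matrix m n ℂ) : ℝ := ‖M‖

variable {dim : (Fin r → ℕ) → ℕ} {A B C F : Finset (Site ν r)}

/-- The block `M_{𝔫'}^{𝔫''}`, with row site `𝔫'` and column site `𝔫''`. -/
def block (M : BlockMat dim C B) (n' : {n // n ∈ C}) (n'' : {n // n ∈ B}) :
    Matrix (Fin (dim n'.1.2)) (Fin (dim n''.1.2)) ℂ :=
  Matrix.of fun p q => M ⟨n', p⟩ ⟨n'', q⟩

/-- `[M(k)]`: the supremum of `‖M_{𝔫'}^{𝔫''}‖₀` over row and column sites with `𝔫' - 𝔫'' = k`,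
and `0` (the supremum of the empty family) if there are none. -/
noncomputable def blockSup (M : BlockMat dim C B) (k : LatticePt ν r) : ℝ :=
  ⨆ p : {p : {n // n ∈ C} × {n // n ∈ B} // siteSub p.1.1 p.2.1 = k},
    opNorm (block M p.1.1 p.1.2)

/-- The strong `s`-norm, `|M|_s² = K₀ ∑_k [M(k)]² ⟨k⟩^{2s}`.  Only finitely many terms of the
sum are nonzero, since the index sets are finite. -/
noncomputable def sNorm (K₀ s : ℝ) (M : BlockMat dim C B) : ℝ :=
  Real.sqrt (K₀ * ∑' k : LatticePt ν r, blockSup M k ^ 2 * bracket k ^ (2 * s))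

/-- The block-diagonal part `Diag(𝓐)`. -/
def blockDiag (M : BlockMat dim A A) : BlockMat dim A A :=
  Matrix.of fun i j => if i.1 = j.1 then M i j else 0

/-- The submatrix `𝓐^𝔉_𝔉` for `𝔉 ⊆ 𝔄`. -/
def restrict (h : F ⊆ A) (M : BlockMat dim A A) : BlockMat dim F F :=
  Matrix.of fun i j => M ⟨⟨i.1.1, h i.1.2⟩, i.2⟩ ⟨⟨j.1.1, h j.1.2⟩, j.2⟩

/-- Every diagonal block is scalar, `𝓐^𝔫_𝔫 = μ̃_𝔫 I`. -/
def HasScalarDiag (M : BlockMat dim A A) : Prop :=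
  ∀ n : {n // n ∈ A}, ∃ μ : ℂ, block M n n = μ • (1 : Matrix _ _ ℂ)

/-- `𝓐` is `N`-good.  Here `S` is the upper end of the range `[s₀, S]` of regularities. -/
def IsGoodMatrix (K₀ s₀ S τ₂ δ N : ℝ) (M : BlockMat dim F F) : Prop :=
  DiamLE F (4 * N) ∧ IsUnit M ∧ ∀ s ∈ Set.Icc s₀ S, sNorm K₀ s M⁻¹ ≤ N ^ (τ₂ + δ * s)

/-- `𝔫` is regular for `𝓐`: the diagonal block is `μ̃_𝔫 I` with `|μ̃_𝔫| ≥ Θ`. -/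
def IsRegularSite (Θ : ℝ) (M : BlockMat dim A A) (n : {n // n ∈ A}) : Prop :=
  ∃ μ : ℂ, block M n n = μ • (1 : Matrix _ _ ℂ) ∧ Θ ≤ ‖μ‖

/-- `𝔫` is `(𝓐, N)`-regular. -/
def IsScaleRegularSite (K₀ s₀ S τ₂ δ N : ℝ) (M : BlockMat dim A A) (n : {n // n ∈ A}) : Prop :=
  ∃ (F : Finset (Site ν r)) (h : F ⊆ A), DiamLE F (4 * N) ∧ DistGE {n.1} (A \ F) N ∧
    IsGoodMatrix K₀ s₀ S τ₂ δ N (restrict h M)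

/-- `𝔫` is `(𝓐, N)`-good. -/
def IsGoodSite (K₀ s₀ S τ₂ δ Θ N : ℝ) (M : BlockMat dim A A) (n : {n // n ∈ A}) : Prop :=
  IsRegularSite Θ M n ∨ IsScaleRegularSite K₀ s₀ S τ₂ δ N M n

open scoped Classical in
/-- The set of `(𝓐, N)`-bad sites of `𝔄`. -/
noncomputable def badSites (K₀ s₀ S τ₂ δ Θ N : ℝ) (M : BlockMat dim A A) : Finset (Site ν r) :=
  A.filter fun n => ∃ h : n ∈ A, ¬ IsGoodSite K₀ s₀ S τ₂ δ Θ N M ⟨n, h⟩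

/-- `𝔅` has a partition into clusters of diameter at most `D` at mutual distance at least `R`. -/
def HasSeparatedPartition (B : Finset (Site ν r)) (D R : ℝ) : Prop :=
  ∃ P : Finpartition B, (∀ O ∈ P.parts, DiamLE O D) ∧
    ∀ O ∈ P.parts, ∀ O' ∈ P.parts, O ≠ O' → DistGE O O' R

end Multiscale

/-! ### Weights on the lattice and `ℓ²` inequalities -/

namespace Multiscale

variable {ν r : ℕ}

/-! Write `Q` for the off-diagonal part, `b = ν + r` and `S = s₁ - ϱ`. The good unknowns are
eliminated, the reduced system on the bad sites is inverted cluster by cluster, and the pieces are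
recombined by tame product estimates.

Elimination (`exists_elimination`). Every good site `x` has a matrix `f x` for which row `x` of `f x
* M` is nearly the unit row: the inverse scalar `μ⁻¹` if `|μ| ≥ Θ`, otherwise the inverse of `M`
restricted to a window `F`. In the first case the error is of size `Υ / Θ`; in the second it is
supported at distance at least `N` from `x`, where the bound at regularity `S` yields a negative
power of `N`. Assembling the rows gives `L * M = 1 - πB + Γ` with `πB` the projection on the bad
sites and `Γ` small at regularity `s₀`. With `X` the inverse of `1 + Γ * (1 - πB)` this becomes `1 =
X * L * M + (1 - X * Γ) * πB`: the data and the bad unknowns determine everything.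

Reduced matrix (`elimination_identities`). Let `π'` project on the sites with `|μ| < Θ` and put `P =
π' * M * (1 - X * Γ) * πB`. Thanks to `π'` no large diagonal entry enters the estimates, and the
discarded rows carry no information because `M * (1 - X * Γ) * πB` vanishes there. Hence `πB * M⁻¹`
is a left inverse of `P`, with operator norm controlled by (A2). Any other `Y` with `Y * P = πB`
recovers `M⁻¹` as well, so it suffices to find one with decay.

Clusters (`exists_cluster_left_inverse`, `sNorm_inv_le`). The part `R` of `P` at distance more than
`N² / 4` from the cluster of the column is small by decay. The remaining part has a left inverse
bounded in operator norm, which by separation of the clusters may be cut down to blocks near the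
clusters. These have range at most `2 * N ^ C₁`, so boundedness turns into decay at the price of
powers of `N ^ C₁`. A last Neumann inversion restores `R`.

Constants. `Θ₀` is chosen before `s₂`, so the smallness required by the Neumann inversions must not
involve `s₂` through the `Υ / Θ` term. This is the purpose of the asymmetric product estimate in
`TamePair`: the factor `κ` of the critical term is fixed, and only `K` depends on the range of
regularities. -/

theorem one_le_bracket (k : LatticePt ν r) : 1 ≤ bracket k := le_max_left _ _

theorem bracket_pos (k : LatticePt ν r) : 0 < bracket k := one_pos.trans_le (one_le_bracket k)

theorem norm_le_bracket (k : LatticePt ν r) : ‖k‖ ≤ bracket k := le_max_right _ _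

theorem bracket_zero : bracket (0 : LatticePt ν r) = 1 := by simp [bracket]

theorem bracket_add_le (k l : LatticePt ν r) : bracket (k + l) ≤ bracket k + bracket l := by
  refine max_le ?_ ?_
  · linarith [one_le_bracket k, one_le_bracket l]
  · exact (norm_add_le k l).trans (add_le_add (norm_le_bracket k) (norm_le_bracket l))

theorem bracket_rpow_nonneg (k : LatticePt ν r) (s : ℝ) : 0 ≤ bracket k ^ s :=
  Real.rpow_nonneg (bracket_pos k).le s

theorem bracket_rpow_mul_self (k : LatticePt ν r) (s : ℝ) :
    bracket k ^ (2 * s) = (bracket k ^ s) ^ 2 := by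
  rw [← Real.rpow_natCast, ← Real.rpow_mul (bracket_pos k).le]; congr 1; push_cast; ring

/-- The points embed isometrically into the `ℤ`-span of the standard basis of `ℝ^ν × ℝ^r`, a lattice
of rank `ν + r`. -/
theorem summable_norm_rpow_latticePt {p : ℝ} (hp : (ν : ℝ) + r < p) :
    Summable fun k : LatticePt ν r => ‖k‖ ^ (-p) := by
  let b := (Pi.basisFun ℝ (Fin ν)).prod (Pi.basisFun ℝ (Fin r))
  let L : Submodule ℤ ((Fin ν → ℝ) × (Fin r → ℝ)) := Submodule.span ℤ (Set.range b)
  have hrank : Module.finrank ℤ L = ν + r := by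
    rw [ZLattice.rank ℝ L]; simp
  have hs := ZLattice.summable_norm_rpow L (-p) (by rw [hrank]; push_cast; linarith)
  have hmem : ∀ k : LatticePt ν r,
      ((fun i => (k.1 i : ℝ), fun i => (k.2 i : ℝ)) : (Fin ν → ℝ) × (Fin r → ℝ)) ∈ L := by
    intro k
    refine (b.mem_span_iff_repr_mem ℤ _).2 ?_
    rintro (i | i)
    · exact ⟨k.1 i, by simp [b]⟩
    · exact ⟨k.2 i, by simp [b]⟩
  let φ : LatticePt ν r → L := fun k => ⟨_, hmem k⟩
  have hφ : Function.Injective φ := by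
    intro k k' h
    have h' := congrArg Subtype.val h
    simp only [φ, Prod.mk.injEq, funext_iff, Int.cast_inj] at h'
    exact Prod.ext (funext h'.1) (funext h'.2)
  refine (hs.comp_injective hφ).congr fun k => ?_
  have : ‖φ k‖ = ‖k‖ := by
    simp only [φ, Submodule.coe_norm, Prod.norm_def, Pi.norm_def]
    congr 3
  rw [Function.comp_apply, this]

theorem summable_bracket_rpow {p : ℝ} (hp : (ν : ℝ) + r < p) :
    Summable fun k : LatticePt ν r => bracket k ^ (-p) := by
  -- Since `0 ^ (-p) = 0` for `p > 0`, the power of the norm does not dominate the weight at the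
  -- origin, which gets its own summand.
  have h1 : Summable fun k : LatticePt ν r => if k = 0 then (1 : ℝ) else 0 :=
    summable_of_ne_finset_zero (s := {0}) (by intro k hk; simpa using hk)
  refine Summable.of_nonneg_of_le (fun k => bracket_rpow_nonneg k _) (fun k => ?_)
    ((summable_norm_rpow_latticePt hp).add h1)
  have hp0 : 0 < p := lt_of_le_of_lt (by positivity) hp
  by_cases hk : k = 0
  · subst hk; simp [bracket_zero]
    exact Real.rpow_nonneg le_rfl _
  · simp only [hk, if_false, add_zero]
    exact Real.rpow_le_rpow_of_nonpos (norm_pos_iff.2 hk) (norm_le_bracket k) (by linarith)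

/-- The asymmetric weight inequality: the factor in front of `⟨l⟩ ^ s` does not depend on `s`. -/
theorem exists_bracket_rpow_add_le (s : ℝ) :
    ∃ K : ℝ, 0 ≤ K ∧ ∀ t, 0 ≤ t → t ≤ s → ∀ k l : LatticePt ν r,
      bracket (k + l) ^ t ≤ 2 * bracket l ^ t + K * bracket k ^ t := by
  by_cases hs : s ≤ 0
  · refine ⟨0, le_rfl, fun t ht hts k l => ?_⟩
    obtain rfl : t = 0 := by linarith
    simp
  push Not at hs
  -- `c` is so small that `(1 + c) ^ s ≤ 2`: where `⟨k⟩ ≤ c ⟨l⟩` the factor stays at `2`, and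
  -- elsewhere `⟨l⟩ ≤ c⁻¹ ⟨k⟩`, so the whole loss falls on `⟨k⟩`.
  obtain ⟨c, hc, hcs⟩ : ∃ c : ℝ, 0 < c ∧ (1 + c) ^ s ≤ 2 := by
    refine ⟨2 ^ s⁻¹ - 1, ?_, ?_⟩
    · have := Real.one_lt_rpow (x := 2) one_lt_two (inv_pos.2 hs)
      linarith
    · rw [add_sub_cancel, ← Real.rpow_mul zero_le_two, inv_mul_cancel₀ hs.ne', Real.rpow_one]
  refine ⟨(1 + c⁻¹) ^ s, by positivity, fun t ht hts k l => ?_⟩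
  have hk := bracket_pos k
  have hl := bracket_pos l
  have h1 : bracket (k + l) ^ t ≤ (bracket k + bracket l) ^ t :=
    Real.rpow_le_rpow (bracket_pos _).le (bracket_add_le k l) ht
  refine h1.trans ?_
  by_cases h : bracket k ≤ c * bracket l
  · calc (bracket k + bracket l) ^ t ≤ ((1 + c) * bracket l) ^ t :=
          Real.rpow_le_rpow (by positivity) (by linarith) ht
      _ = (1 + c) ^ t * bracket l ^ t := Real.mul_rpow (by positivity) hl.le
      _ ≤ 2 * bracket l ^ t := by
          gcongr
          exact (Real.rpow_le_rpow_of_exponent_le (by linarith) hts).trans hcs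
      _ ≤ _ := le_add_of_nonneg_right (by positivity)
  · push Not at h
    have hl' : bracket l ≤ c⁻¹ * bracket k := by
      rw [inv_mul_eq_div, le_div_iff₀ hc]; linarith
    calc (bracket k + bracket l) ^ t ≤ ((1 + c⁻¹) * bracket k) ^ t :=
          Real.rpow_le_rpow (by positivity) (by linarith) ht
      _ = (1 + c⁻¹) ^ t * bracket k ^ t := Real.mul_rpow (by positivity) hk.le
      _ ≤ (1 + c⁻¹) ^ s * bracket k ^ t := by
          gcongr
          have : 0 < c⁻¹ := inv_pos.2 hc
          linarith
      _ ≤ _ := le_add_of_nonneg_left (by positivity)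

/-- Minkowski's inequality for `ℓ²` over a finite set. -/
theorem sqrt_sum_add_sq_le {ι : Type*} (U : Finset ι) (f g : ι → ℝ) :
    √(∑ i ∈ U, (f i + g i) ^ 2) ≤ √(∑ i ∈ U, f i ^ 2) + √(∑ i ∈ U, g i ^ 2) := by
  have h := norm_add_le (WithLp.toLp 2 fun i : U => f i : EuclideanSpace ℝ U)
    (WithLp.toLp 2 fun i : U => g i)
  simp only [EuclideanSpace.norm_eq, PiLp.add_apply, Real.norm_eq_abs, sq_abs] at h
  rwa [Finset.sum_coe_sort U (fun i => (f i + g i) ^ 2), Finset.sum_coe_sort U (fun i => f i ^ 2),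
    Finset.sum_coe_sort U (fun i => g i ^ 2)] at h

/-- Young's inequality `ℓ¹ * ℓ² ⊆ ℓ²` for a finitely supported kernel. -/
theorem sum_sq_sum_mul_sub_le {G : Type*} [AddCommGroup G] (T U : Finset G) (a g : G → ℝ) {Z : ℝ}
    (ha : ∀ k, 0 ≤ a k) (hZ : ∀ V : Finset G, ∑ n ∈ V, g n ^ 2 ≤ Z) :
    ∑ n ∈ U, (∑ m ∈ T, a m * g (n - m)) ^ 2 ≤ (∑ m ∈ T, a m) ^ 2 * Z := by
  classical
  have h1 : ∀ n, (∑ m ∈ T, a m * g (n - m)) ^ 2 ≤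
      (∑ m ∈ T, a m) * ∑ m ∈ T, a m * g (n - m) ^ 2 := fun n =>
    Finset.sum_sq_le_sum_mul_sum_of_sq_le_mul T (fun m _ => ha m)
      (fun m _ => mul_nonneg (ha m) (sq_nonneg _)) fun m _ => le_of_eq (by ring)
  have h2 : ∀ m, ∑ n ∈ U, g (n - m) ^ 2 ≤ Z := fun m => by
    have := hZ (U.image fun n => n - m)
    rwa [Finset.sum_image fun x _ y _ h => sub_left_injective h] at this
  calc ∑ n ∈ U, (∑ m ∈ T, a m * g (n - m)) ^ 2
      ≤ ∑ n ∈ U, (∑ m ∈ T, a m) * ∑ m ∈ T, a m * g (n - m) ^ 2 := Finset.sum_le_sum fun n _ => h1 n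
    _ = (∑ m ∈ T, a m) * ∑ m ∈ T, a m * ∑ n ∈ U, g (n - m) ^ 2 := by
        rw [← Finset.mul_sum, Finset.sum_comm]; simp_rw [Finset.mul_sum]
    _ ≤ (∑ m ∈ T, a m) * ∑ m ∈ T, a m * Z := by
        gcongr with m _
        · exact Finset.sum_nonneg fun m _ => ha m
        · exact ha m
        · exact h2 m
    _ = _ := by rw [← Finset.sum_mul]; ring

end Multiscale

/-! ### Operator norms of block matrices -/

namespace Multiscale

variable {ν r : ℕ}

section OpNorm

variable {l m n : Type*} [Fintype l] [Fintype m] [Fintype n] [DecidableEq n]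

open scoped Matrix.Norms.L2Operator

theorem opNorm_nonneg (M : Matrix m n ℂ) : 0 ≤ opNorm M := norm_nonneg M

theorem opNorm_zero : opNorm (0 : Matrix m n ℂ) = 0 := norm_zero

theorem opNorm_eq_zero {M : Matrix m n ℂ} : opNorm M = 0 ↔ M = 0 := norm_eq_zero

theorem opNorm_neg (M : Matrix m n ℂ) : opNorm (-M) = opNorm M := norm_neg M

theorem opNorm_add_le (M M' : Matrix m n ℂ) : opNorm (M + M') ≤ opNorm M + opNorm M' :=
  norm_add_le M M'

theorem opNorm_sum_le {ι : Type*} (s : Finset ι) (f : ι → Matrix m n ℂ) :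
    opNorm (∑ i ∈ s, f i) ≤ ∑ i ∈ s, opNorm (f i) := norm_sum_le s f

theorem opNorm_mul_le [DecidableEq m] (M : Matrix l m ℂ) (M' : Matrix m n ℂ) :
    opNorm (M * M') ≤ opNorm M * opNorm M' := Matrix.l2_opNorm_mul M M'

theorem norm_mulVec_le (M : Matrix m n ℂ) (x : n → ℂ) :
    ‖(WithLp.toLp 2 (M.mulVec x) : EuclideanSpace ℂ m)‖ ≤
      opNorm M * ‖(WithLp.toLp 2 x : EuclideanSpace ℂ n)‖ :=
  Matrix.l2_opNorm_mulVec M (WithLp.toLp 2 x)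

theorem opNorm_le_bound (M : Matrix m n ℂ) {c : ℝ} (hc : 0 ≤ c)
    (h : ∀ x : n → ℂ, ‖(WithLp.toLp 2 (M.mulVec x) : EuclideanSpace ℂ m)‖ ≤
      c * ‖(WithLp.toLp 2 x : EuclideanSpace ℂ n)‖) : opNorm M ≤ c := by
  unfold opNorm
  rw [Matrix.l2_opNorm_def]
  exact ContinuousLinearMap.opNorm_le_bound _ hc fun x => h x.ofLp

theorem opNorm_smul_one_le (μ : ℂ) : opNorm (μ • (1 : Matrix n n ℂ)) ≤ ‖μ‖ := by
  refine opNorm_le_bound _ (norm_nonneg _) fun x => ?_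
  rw [Matrix.smul_mulVec, Matrix.one_mulVec, WithLp.toLp_smul, norm_smul]

end OpNorm

variable {dim : (Fin r → ℕ) → ℕ} {A B C F : Finset (Site ν r)}

theorem block_add (M M' : BlockMat dim C B) (n' n'') :
    block (M + M') n' n'' = block M n' n'' + block M' n' n'' := rfl

theorem block_neg (M : BlockMat dim C B) (n' n'') : block (-M) n' n'' = -block M n' n'' := rfl

theorem block_mul (M : BlockMat dim C A) (M' : BlockMat dim A B) (n' n'') :
    block (M * M') n' n'' = ∑ m, block M n' m * block M' m n'' := by
  ext p q
  simp only [block, Matrix.of_apply, Matrix.mul_apply, Matrix.sum_apply]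
  exact Fintype.sum_sigma _

theorem eq_of_block_eq {M M' : BlockMat dim C B} (h : ∀ n' n'', block M n' n'' = block M' n' n'') :
    M = M' := by
  ext ⟨n', p⟩ ⟨n'', q⟩
  exact congrFun (congrFun (h n' n'') p) q

theorem norm_sq_eq_sum_blocks (x : BlockIdx dim B → ℂ) :
    ‖(WithLp.toLp 2 x : EuclideanSpace ℂ (BlockIdx dim B))‖ ^ 2 =
      ∑ n, ‖(WithLp.toLp 2 (fun p => x ⟨n, p⟩) : EuclideanSpace ℂ (Fin (dim n.1.2)))‖ ^ 2 := by
  simp only [EuclideanSpace.norm_sq_eq]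
  exact Fintype.sum_sigma _

theorem mulVec_block (M : BlockMat dim C B) (x : BlockIdx dim B → ℂ) (n : {n // n ∈ C}) :
    (fun p => M.mulVec x ⟨n, p⟩) = ∑ m, (block M n m).mulVec fun p => x ⟨m, p⟩ := by
  ext p
  simp only [Matrix.mulVec, dotProduct, Finset.sum_apply, block, Matrix.of_apply]
  exact Fintype.sum_sigma _

theorem opNorm_block_le (M : BlockMat dim C B) (n' n'') : opNorm (block M n' n'') ≤ opNorm M := by
  classical
  refine opNorm_le_bound _ (opNorm_nonneg _) fun x => ?_
  let y : BlockIdx dim B → ℂ := fun i => if h : i.1 = n'' then x (h ▸ i.2) else 0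
  have hy : ∀ m, (fun p => y ⟨m, p⟩) = if h : m = n'' then h ▸ x else 0 := by
    intro m
    by_cases h : m = n''
    · subst h; simp [y]
    · ext p; simp [y, h]
  have h1 : ‖(WithLp.toLp 2 y : EuclideanSpace ℂ (BlockIdx dim B))‖ =
      ‖(WithLp.toLp 2 x : EuclideanSpace ℂ (Fin (dim n''.1.2)))‖ := by
    rw [← sq_eq_sq₀ (norm_nonneg _) (norm_nonneg _), norm_sq_eq_sum_blocks]
    rw [Finset.sum_eq_single n'']
    · rw [hy]; simp
    · intro m _ hm
      rw [hy]; simp [hm]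
    · simp
  have h2 : (fun p => M.mulVec y ⟨n', p⟩) = (block M n' n'').mulVec x := by
    rw [mulVec_block, Finset.sum_eq_single n'']
    · rw [hy]; simp
    · intro m _ hm
      rw [hy]; simp [hm]
    · simp
  rw [← h1, ← h2]
  refine le_trans ?_ (norm_mulVec_le M y)
  rw [← sq_le_sq₀ (norm_nonneg _) (norm_nonneg _), norm_sq_eq_sum_blocks (M.mulVec y)]
  exact Finset.single_le_sum (f := fun n =>
    ‖(WithLp.toLp 2 (fun p => M.mulVec y ⟨n, p⟩) : EuclideanSpace ℂ (Fin (dim n.1.2)))‖ ^ 2)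
    (fun _ _ => sq_nonneg _) (Finset.mem_univ n')

/-- Schur's test. -/
theorem sum_sq_sum_mul_le {ι κ : Type*} [Fintype ι] [Fintype κ] (a : ι → κ → ℝ) (ξ : κ → ℝ)
    {α : ℝ} (ha : ∀ i j, 0 ≤ a i j) (hα : 0 ≤ α) (hrow : ∀ i, ∑ j, a i j ≤ α)
    (hcol : ∀ j, ∑ i, a i j ≤ α) :
    ∑ i, (∑ j, a i j * ξ j) ^ 2 ≤ α ^ 2 * ∑ j, ξ j ^ 2 := by
  have h1 : ∀ i, (∑ j, a i j * ξ j) ^ 2 ≤ (∑ j, a i j) * ∑ j, a i j * ξ j ^ 2 := fun i =>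
    Finset.sum_sq_le_sum_mul_sum_of_sq_le_mul _ (fun j _ => ha i j)
      (fun j _ => mul_nonneg (ha i j) (sq_nonneg _)) fun j _ => le_of_eq (by ring)
  calc ∑ i, (∑ j, a i j * ξ j) ^ 2 ≤ ∑ i, α * ∑ j, a i j * ξ j ^ 2 :=
        Finset.sum_le_sum fun i _ => (h1 i).trans (mul_le_mul_of_nonneg_right (hrow i)
          (Finset.sum_nonneg fun j _ => mul_nonneg (ha i j) (sq_nonneg _)))
    _ = α * ∑ j, (∑ i, a i j) * ξ j ^ 2 := by
        rw [← Finset.mul_sum, Finset.sum_comm]; simp_rw [Finset.sum_mul]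
    _ ≤ α * ∑ j, α * ξ j ^ 2 := by
        gcongr with j _
        exact hcol j
    _ = _ := by rw [← Finset.mul_sum]; ring

theorem opNorm_le_of_schur (M : BlockMat dim C B) {α : ℝ} (hα : 0 ≤ α)
    (hrow : ∀ n', ∑ n'', opNorm (block M n' n'') ≤ α)
    (hcol : ∀ n'', ∑ n', opNorm (block M n' n'') ≤ α) : opNorm M ≤ α := by
  refine opNorm_le_bound _ hα fun x => ?_
  rw [← sq_le_sq₀ (norm_nonneg _) (by positivity), mul_pow, norm_sq_eq_sum_blocks,
    norm_sq_eq_sum_blocks]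
  refine le_trans ?_ (sum_sq_sum_mul_le _ _ (fun _ _ => opNorm_nonneg _) hα hrow hcol)
  refine Finset.sum_le_sum fun n _ => ?_
  gcongr
  rw [mulVec_block, WithLp.toLp_sum]
  exact (norm_sum_le _ _).trans (Finset.sum_le_sum fun m _ => norm_mulVec_le _ _)

end Multiscale

/-! ### The strong norms: smoothing and decay -/

namespace Multiscale

variable {ν r : ℕ} {dim : (Fin r → ℕ) → ℕ} {A B C C' B' F : Finset (Site ν r)}

theorem siteSub_self (n : Site ν r) : siteSub n n = 0 := by
  ext <;> simp [siteSub]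

theorem siteSub_add_siteSub (x y z : Site ν r) : siteSub x y + siteSub y z = siteSub x z := by
  ext <;> simp [siteSub]

theorem siteSub_left_injective (z : Site ν r) : Function.Injective fun x => siteSub x z := by
  intro x y h
  simp only [siteSub, Prod.mk.injEq, sub_left_inj, funext_iff, Int.natCast_inj] at h
  exact Prod.ext (funext h.1) (funext h.2)

theorem siteSub_right_injective (x : Site ν r) : Function.Injective (siteSub x) := by
  intro y z h
  simp only [siteSub, Prod.mk.injEq, sub_right_inj, funext_iff, Int.natCast_inj] at h
  exact Prod.ext (funext h.1) (funext h.2)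

theorem siteDist_comm (x y : Site ν r) : siteDist x y = siteDist y x := by
  have : siteSub x y = -siteSub y x := by ext <;> simp [siteSub]
  rw [siteDist, this, norm_neg, siteDist]

theorem siteDist_triangle (x y z : Site ν r) : siteDist x z ≤ siteDist x y + siteDist y z := by
  rw [siteDist, ← siteSub_add_siteSub x y z]
  exact norm_add_le _ _

theorem siteDist_self (x : Site ν r) : siteDist x x = 0 := by
  rw [siteDist, siteSub_self, norm_zero]

theorem siteDist_le_bracket (x y : Site ν r) : siteDist x y ≤ bracket (siteSub x y) :=
  norm_le_bracket _

theorem bracket_le_of_siteDist_le {x y : Site ν r} {R : ℝ} (hR : 1 ≤ R) (h : siteDist x y ≤ R) :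
    bracket (siteSub x y) ≤ R := max_le hR h

/-- The set of differences `ℭ - 𝔅`. -/
def diffSet (C B : Finset (Site ν r)) : Finset (LatticePt ν r) :=
  (C ×ˢ B).image fun p => siteSub p.1 p.2

theorem siteSub_mem_diffSet (x : {n // n ∈ C}) (y : {n // n ∈ B}) :
    siteSub x.1 y.1 ∈ diffSet C B :=
  Finset.mem_image.2 ⟨(x.1, y.1), Finset.mem_product.2 ⟨x.2, y.2⟩, rfl⟩

theorem blockSup_nonneg (M : BlockMat dim C B) (k : LatticePt ν r) : 0 ≤ blockSup M k :=
  Real.iSup_nonneg fun _ => opNorm_nonneg _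

theorem opNorm_block_le_blockSup (M : BlockMat dim C B) (x y) :
    opNorm (block M x y) ≤ blockSup M (siteSub x.1 y.1) :=
  le_ciSup (f := fun p : {p : {n // n ∈ C} × {n // n ∈ B} //
    siteSub p.1.1 p.2.1 = siteSub x.1 y.1} => opNorm (block M p.1.1 p.1.2))
    (Set.finite_range _).bddAbove ⟨(x, y), rfl⟩

theorem blockSup_le {M : BlockMat dim C B} {k : LatticePt ν r} {X : ℝ} (hX : 0 ≤ X)
    (h : ∀ x y, siteSub x.1 y.1 = k → opNorm (block M x y) ≤ X) : blockSup M k ≤ X :=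
  Real.iSup_le (fun p => h p.1.1 p.1.2 p.2) hX

theorem blockSup_eq_zero {M : BlockMat dim C B} {k : LatticePt ν r} (hk : k ∉ diffSet C B) :
    blockSup M k = 0 :=
  le_antisymm (blockSup_le le_rfl fun x y h => absurd (h ▸ siteSub_mem_diffSet x y) hk)
    (blockSup_nonneg M k)

/-- The freedom in `D` allows norms of matrices over different index sets to be compared term by
term in one finite sum. -/
theorem sNorm_eq_sum (K₀ s : ℝ) (M : BlockMat dim C B) {D : Finset (LatticePt ν r)}
    (hD : diffSet C B ⊆ D) :
    sNorm K₀ s M = √(K₀ * ∑ k ∈ D, (blockSup M k * bracket k ^ s) ^ 2) := by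
  rw [sNorm, tsum_eq_sum (s := D)]
  · simp_rw [mul_pow, bracket_rpow_mul_self]
  · intro k hk
    rw [blockSup_eq_zero fun h => hk (hD h)]; simp

theorem sNorm_nonneg (K₀ s : ℝ) (M : BlockMat dim C B) : 0 ≤ sNorm K₀ s M := Real.sqrt_nonneg _

theorem sum_sq_le_of_sNorm {K₀ : ℝ} (hK : 0 < K₀) (s : ℝ) (M : BlockMat dim C B)
    (V : Finset (LatticePt ν r)) :
    ∑ k ∈ V, (blockSup M k * bracket k ^ s) ^ 2 ≤ sNorm K₀ s M ^ 2 / K₀ := by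
  rw [sNorm_eq_sum K₀ s M (D := diffSet C B ∪ V) Finset.subset_union_left,
    Real.sq_sqrt (mul_nonneg hK.le (Finset.sum_nonneg fun _ _ => sq_nonneg _)),
    mul_div_cancel_left₀ _ hK.ne']
  exact Finset.sum_le_sum_of_subset_of_nonneg Finset.subset_union_right fun _ _ _ => sq_nonneg _

theorem sNorm_le_mul_sNorm {K₀ : ℝ} (hK : 0 ≤ K₀) {s s' c : ℝ} (hc : 0 ≤ c)
    {M : BlockMat dim C B} {M' : BlockMat dim C' B'}
    (h : ∀ k, blockSup M k * bracket k ^ s ≤ c * (blockSup M' k * bracket k ^ s')) :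
    sNorm K₀ s M ≤ c * sNorm K₀ s' M' := by
  rw [sNorm_eq_sum K₀ s M (D := diffSet C B ∪ diffSet C' B') Finset.subset_union_left,
    sNorm_eq_sum K₀ s' M' (D := diffSet C B ∪ diffSet C' B') Finset.subset_union_right]
  conv_rhs => rw [← Real.sqrt_sq hc, ← Real.sqrt_mul (sq_nonneg c)]
  apply Real.sqrt_le_sqrt
  rw [mul_left_comm, Finset.mul_sum (a := c ^ 2)]
  refine mul_le_mul_of_nonneg_left (Finset.sum_le_sum fun k _ => ?_) hK
  rw [← mul_pow]
  exact pow_le_pow_left₀ (mul_nonneg (blockSup_nonneg _ _) (bracket_rpow_nonneg _ _)) (h k) 2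

theorem sNorm_mono_of_block {K₀ : ℝ} (hK : 0 ≤ K₀) (s : ℝ) {M M' : BlockMat dim C B}
    (h : ∀ x y, opNorm (block M x y) ≤ opNorm (block M' x y)) :
    sNorm K₀ s M ≤ sNorm K₀ s M' := by
  have := sNorm_le_mul_sNorm hK (s := s) (s' := s) zero_le_one (M := M) (M' := M') fun k => by
    rw [one_mul]
    refine mul_le_mul_of_nonneg_right (blockSup_le (blockSup_nonneg _ _) fun x y hxy => ?_)
      (bracket_rpow_nonneg _ _)
    exact hxy ▸ (h x y).trans (opNorm_block_le_blockSup M' x y)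
  simpa using this

theorem sNorm_mono_exponent {K₀ : ℝ} (hK : 0 ≤ K₀) {s s' : ℝ} (h : s ≤ s') (M : BlockMat dim C B) :
    sNorm K₀ s M ≤ sNorm K₀ s' M := by
  have := sNorm_le_mul_sNorm hK (s := s) (s' := s') zero_le_one (M := M) (M' := M) fun k => by
    rw [one_mul]
    exact mul_le_mul_of_nonneg_left (Real.rpow_le_rpow_of_exponent_le (one_le_bracket k) h)
      (blockSup_nonneg _ _)
  simpa using this

/-- Smoothing for matrices supported near the diagonal. -/
theorem sNorm_le_of_near {K₀ : ℝ} (hK : 0 ≤ K₀) {s s' ρ : ℝ} (hss : s ≤ s') (hρ : 0 ≤ ρ)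
    {M : BlockMat dim C B} (h : ∀ x y, block M x y ≠ 0 → bracket (siteSub x.1 y.1) ≤ ρ) :
    sNorm K₀ s' M ≤ ρ ^ (s' - s) * sNorm K₀ s M := by
  refine sNorm_le_mul_sNorm hK (Real.rpow_nonneg hρ _) fun k => ?_
  by_cases hk : bracket k ≤ ρ
  · rw [mul_left_comm]
    refine mul_le_mul_of_nonneg_left ?_ (blockSup_nonneg _ _)
    calc bracket k ^ s' = bracket k ^ (s' - s) * bracket k ^ s := by
          rw [← Real.rpow_add (bracket_pos k)]; congr 1; ring
      _ ≤ _ := by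
          refine mul_le_mul_of_nonneg_right ?_ (bracket_rpow_nonneg _ _)
          exact Real.rpow_le_rpow (bracket_pos k).le hk (sub_nonneg.2 hss)
  · have : blockSup M k = 0 := by
      refine le_antisymm (blockSup_le le_rfl fun x y hxy => ?_) (blockSup_nonneg _ _)
      by_contra hne
      exact hk (hxy ▸ h x y fun h0 => hne (by rw [h0, opNorm_zero]))
    simp [this]

/-- Smoothing for matrices supported away from the diagonal. -/
theorem sNorm_le_of_far {K₀ : ℝ} (hK : 0 ≤ K₀) {s s' ρ : ℝ} (hss : s ≤ s') (hρ : 0 < ρ)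
    {M : BlockMat dim C B} (h : ∀ x y, block M x y ≠ 0 → ρ ≤ bracket (siteSub x.1 y.1)) :
    sNorm K₀ s M ≤ ρ ^ (s - s') * sNorm K₀ s' M := by
  refine sNorm_le_mul_sNorm hK (Real.rpow_nonneg hρ.le _) fun k => ?_
  by_cases hk : ρ ≤ bracket k
  · rw [mul_left_comm]
    refine mul_le_mul_of_nonneg_left ?_ (blockSup_nonneg _ _)
    calc bracket k ^ s = bracket k ^ (s - s') * bracket k ^ s' := by
          rw [← Real.rpow_add (bracket_pos k)]; congr 1; ring
      _ ≤ _ := by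
          refine mul_le_mul_of_nonneg_right ?_ (bracket_rpow_nonneg _ _)
          exact Real.rpow_le_rpow_of_nonpos hρ hk (sub_nonpos.2 hss)
  · have : blockSup M k = 0 := by
      refine le_antisymm (blockSup_le le_rfl fun x y hxy => ?_) (blockSup_nonneg _ _)
      by_contra hne
      exact hk (hxy ▸ h x y fun h0 => hne (by rw [h0, opNorm_zero]))
    simp [this]

theorem sNorm_neg (K₀ s : ℝ) (M : BlockMat dim C B) : sNorm K₀ s (-M) = sNorm K₀ s M := by
  have : blockSup (-M) = blockSup M := by
    ext k; simp only [blockSup, block_neg, opNorm_neg]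
  simp only [sNorm, this]

theorem sNorm_le_of_sum {K₀ : ℝ} (hK : 0 ≤ K₀) {s : ℝ} {M : BlockMat dim C B}
    {f : LatticePt ν r → ℝ} (h : ∀ k ∈ diffSet C B, blockSup M k * bracket k ^ s ≤ f k) :
    sNorm K₀ s M ≤ √K₀ * √(∑ k ∈ diffSet C B, f k ^ 2) := by
  rw [sNorm_eq_sum K₀ s M subset_rfl, ← Real.sqrt_mul hK]
  refine Real.sqrt_le_sqrt (mul_le_mul_of_nonneg_left (Finset.sum_le_sum fun k hk => ?_) hK)
  exact pow_le_pow_left₀ (mul_nonneg (blockSup_nonneg _ _) (bracket_rpow_nonneg _ _)) (h k hk) 2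

theorem sqrt_mul_sqrt_sum_le_sNorm {K₀ : ℝ} (hK : 0 < K₀) (s : ℝ) (M : BlockMat dim C B)
    (V : Finset (LatticePt ν r)) :
    √K₀ * √(∑ k ∈ V, (blockSup M k * bracket k ^ s) ^ 2) ≤ sNorm K₀ s M := by
  rw [← Real.sqrt_mul hK.le]
  refine Real.sqrt_le_iff.2 ⟨sNorm_nonneg _ _ _, ?_⟩
  have := sum_sq_le_of_sNorm hK s M V
  rwa [le_div_iff₀ hK, mul_comm] at this

theorem sNorm_add_le {K₀ : ℝ} (hK : 0 < K₀) (s : ℝ) (M M' : BlockMat dim C B) :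
    sNorm K₀ s (M + M') ≤ sNorm K₀ s M + sNorm K₀ s M' := by
  refine (sNorm_le_of_sum hK.le (f := fun k =>
    blockSup M k * bracket k ^ s + blockSup M' k * bracket k ^ s) fun k _ => ?_).trans ?_
  · rw [← add_mul]
    refine mul_le_mul_of_nonneg_right (blockSup_le (add_nonneg (blockSup_nonneg _ _)
      (blockSup_nonneg _ _)) fun x y hxy => ?_) (bracket_rpow_nonneg _ _)
    rw [block_add, ← hxy]
    exact (opNorm_add_le _ _).trans
      (add_le_add (opNorm_block_le_blockSup M x y) (opNorm_block_le_blockSup M' x y))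
  · refine (mul_le_mul_of_nonneg_left (sqrt_sum_add_sq_le _ _ _) (Real.sqrt_nonneg _)).trans ?_
    rw [mul_add]
    exact add_le_add (sqrt_mul_sqrt_sum_le_sNorm hK s M _) (sqrt_mul_sqrt_sum_le_sNorm hK s M' _)

/-- Decay of the blocks. -/
theorem opNorm_block_le_sNorm {K₀ : ℝ} (hK : 1 ≤ K₀) (s : ℝ) (M : BlockMat dim C B) (x y) :
    opNorm (block M x y) ≤ sNorm K₀ s M * bracket (siteSub x.1 y.1) ^ (-s) := by
  have h := sqrt_mul_sqrt_sum_le_sNorm (one_pos.trans_le hK) s M {siteSub x.1 y.1}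
  rw [Finset.sum_singleton, Real.sqrt_sq
    (mul_nonneg (blockSup_nonneg _ _) (bracket_rpow_nonneg _ _))] at h
  rw [Real.rpow_neg (bracket_pos _).le, ← div_eq_mul_inv,
    le_div_iff₀ (Real.rpow_pos_of_pos (bracket_pos _) s)]
  have h0 : 0 ≤ blockSup M (siteSub x.1 y.1) * bracket (siteSub x.1 y.1) ^ s :=
    mul_nonneg (blockSup_nonneg _ _) (bracket_rpow_nonneg _ _)
  calc _ ≤ blockSup M (siteSub x.1 y.1) * bracket (siteSub x.1 y.1) ^ s :=
        mul_le_mul_of_nonneg_right (opNorm_block_le_blockSup M x y) (bracket_rpow_nonneg _ _)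
    _ ≤ √K₀ * (blockSup M (siteSub x.1 y.1) * bracket (siteSub x.1 y.1) ^ s) :=
        le_mul_of_one_le_left h0 (Real.one_le_sqrt.2 hK)
    _ ≤ _ := h

/-- Polynomial decay of the blocks controls the strong norms, with a loss of `ν + r`. -/
theorem sNorm_le_of_decay {K₀ : ℝ} (hK : 0 ≤ K₀) {b : ℝ} (hb : (ν : ℝ) + r < 2 * b) {s X : ℝ}
    (hX : 0 ≤ X) {M : BlockMat dim C B}
    (h : ∀ x y, opNorm (block M x y) ≤ X * bracket (siteSub x.1 y.1) ^ (-(s + b))) :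
    sNorm K₀ s M ≤ √(K₀ * ∑' k : LatticePt ν r, bracket k ^ (-(2 * b))) * X := by
  refine (sNorm_le_of_sum hK (f := fun k => X * bracket k ^ (-b)) fun k _ => ?_).trans ?_
  · have : X * bracket k ^ (-b) = X * bracket k ^ (-(s + b)) * bracket k ^ s := by
      rw [mul_assoc, ← Real.rpow_add (bracket_pos k)]; congr 2; ring
    rw [this]
    refine mul_le_mul_of_nonneg_right (blockSup_le (mul_nonneg hX (bracket_rpow_nonneg _ _))
      fun x y hxy => hxy ▸ h x y) (bracket_rpow_nonneg _ _)
  · rw [Real.sqrt_mul hK, mul_assoc]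
    refine mul_le_mul_of_nonneg_left ?_ (Real.sqrt_nonneg _)
    simp_rw [mul_pow]
    rw [← Finset.mul_sum, Real.sqrt_mul (sq_nonneg X), Real.sqrt_sq hX, mul_comm]
    refine mul_le_mul_of_nonneg_right (Real.sqrt_le_sqrt ?_) hX
    have he : ∀ k : LatticePt ν r, (bracket k ^ (-b)) ^ 2 = bracket k ^ (-(2 * b)) := fun k => by
      rw [← bracket_rpow_mul_self]; congr 1; ring
    simp_rw [he]
    exact (summable_bracket_rpow hb).sum_le_tsum _ fun k _ => bracket_rpow_nonneg _ _

/-! ### Tame products -/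

section Algebra

variable {s₀ K₀ : ℝ}

theorem four_lt_of_tsum_lt (hs₀ : (ν : ℝ) + r < 2 * s₀)
    (hK₀ : 4 * ∑' k : LatticePt ν r, bracket k ^ (-(2 * s₀)) < K₀) : 4 < K₀ := by
  have := (summable_bracket_rpow hs₀).sum_le_tsum {(0 : LatticePt ν r)}
    fun k _ => bracket_rpow_nonneg _ _
  rw [Finset.sum_singleton, bracket_zero, Real.one_rpow] at this
  linarith

/-- Cauchy–Schwarz against `⟨k⟩ ^ (-s₀)`. The hypothesis on `K₀` produces the factor `1 / 2`, which
later cancels the `2` of the asymmetric weight inequality. -/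
theorem sum_blockSup_le (hs₀ : (ν : ℝ) + r < 2 * s₀)
    (hK₀ : 4 * ∑' k : LatticePt ν r, bracket k ^ (-(2 * s₀)) < K₀) (M : BlockMat dim C B)
    (V : Finset (LatticePt ν r)) : ∑ k ∈ V, blockSup M k ≤ sNorm K₀ s₀ M / 2 := by
  have hK := four_lt_of_tsum_lt hs₀ hK₀
  have hK' : 0 < K₀ := by linarith
  have h := Finset.sum_mul_sq_le_sq_mul_sq V (fun k => blockSup M k * bracket k ^ s₀)
    fun k => bracket k ^ (-s₀)
  have he : ∀ k : LatticePt ν r,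
      blockSup M k * bracket k ^ s₀ * bracket k ^ (-s₀) = blockSup M k := fun k => by
    rw [mul_assoc, ← Real.rpow_add (bracket_pos k), add_neg_cancel, Real.rpow_zero, mul_one]
  have he' : ∀ k : LatticePt ν r, (bracket k ^ (-s₀)) ^ 2 = bracket k ^ (-(2 * s₀)) := fun k => by
    rw [← bracket_rpow_mul_self]; congr 1; ring
  simp_rw [he, he'] at h
  have h1 := sum_sq_le_of_sNorm hK' s₀ M V
  have h2 := (summable_bracket_rpow hs₀).sum_le_tsum V fun k _ => bracket_rpow_nonneg _ _
  refine abs_le_of_sq_le_sq' ?_ (div_nonneg (sNorm_nonneg _ _ _) zero_le_two) |>.2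
  calc _ ≤ _ := h
    _ ≤ sNorm K₀ s₀ M ^ 2 / K₀ * (K₀ / 4) := by
        refine mul_le_mul h1 (by linarith) (Finset.sum_nonneg fun k _ => bracket_rpow_nonneg _ _)
          (by positivity)
    _ = _ := by field_simp; norm_num

/-- Schur's test: with one site fixed, the difference of two sites determines the other, so row and
column sums are at most the `ℓ¹` norm of `blockSup M`. -/
theorem opNorm_le_sNorm (hs₀ : (ν : ℝ) + r < 2 * s₀)
    (hK₀ : 4 * ∑' k : LatticePt ν r, bracket k ^ (-(2 * s₀)) < K₀) (M : BlockMat dim C B) :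
    opNorm M ≤ sNorm K₀ s₀ M := by
  have h0 := sNorm_nonneg K₀ s₀ M
  refine opNorm_le_of_schur M h0 (fun x => ?_) fun y => ?_
  · calc _ ≤ ∑ y : {n // n ∈ B}, blockSup M (siteSub x.1 y.1) :=
          Finset.sum_le_sum fun y _ => opNorm_block_le_blockSup M x y
      _ = ∑ k ∈ Finset.univ.image fun y : {n // n ∈ B} => siteSub x.1 y.1, blockSup M k := by
          rw [Finset.sum_image fun y _ z _ h => Subtype.ext (siteSub_right_injective x.1 h)]
      _ ≤ _ := sum_blockSup_le hs₀ hK₀ M _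
      _ ≤ _ := by linarith
  · calc _ ≤ ∑ x : {n // n ∈ C}, blockSup M (siteSub x.1 y.1) :=
          Finset.sum_le_sum fun x _ => opNorm_block_le_blockSup M x y
      _ = ∑ k ∈ Finset.univ.image fun x : {n // n ∈ C} => siteSub x.1 y.1, blockSup M k := by
          rw [Finset.sum_image fun x _ z _ h => Subtype.ext (siteSub_left_injective y.1 h)]
      _ ≤ _ := sum_blockSup_le hs₀ hK₀ M _
      _ ≤ _ := by linarith

/-- The tame product estimate, given the weight inequality. -/
theorem sNorm_mul_le_of_weight (hs₀ : (ν : ℝ) + r < 2 * s₀)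
    (hK₀ : 4 * ∑' k : LatticePt ν r, bracket k ^ (-(2 * s₀)) < K₀) {s K : ℝ} (hKn : 0 ≤ K)
    (hw : ∀ k l : LatticePt ν r, bracket (k + l) ^ s ≤ 2 * bracket l ^ s + K * bracket k ^ s)
    (M : BlockMat dim C A) (M' : BlockMat dim A B) :
    sNorm K₀ s (M * M') ≤
      sNorm K₀ s₀ M * sNorm K₀ s M' + K * sNorm K₀ s M * sNorm K₀ s₀ M' := by
  have hK := four_lt_of_tsum_lt hs₀ hK₀
  have hK' : 0 < K₀ := by linarith
  set a := blockSup M with ha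
  set b := blockSup M' with hb
  have ha0 : ∀ k, 0 ≤ a k := blockSup_nonneg M
  have hb0 : ∀ k, 0 ≤ b k := blockSup_nonneg M'
  set α : LatticePt ν r → ℝ := fun k => a k * bracket k ^ s with hα
  set β : LatticePt ν r → ℝ := fun k => b k * bracket k ^ s with hβ
  have hα0 : ∀ k, 0 ≤ α k := fun k => mul_nonneg (ha0 k) (bracket_rpow_nonneg _ _)
  have hβ0 : ∀ k, 0 ≤ β k := fun k => mul_nonneg (hb0 k) (bracket_rpow_nonneg _ _)
  set T := diffSet C A
  set T' := diffSet A B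
  set f : LatticePt ν r → ℝ := fun n => 2 * ∑ m ∈ T, a m * β (n - m) with hf
  set g : LatticePt ν r → ℝ := fun n => K * ∑ m ∈ T', b m * α (n - m) with hg
  have hf0 : ∀ n, 0 ≤ f n := fun n =>
    mul_nonneg zero_le_two (Finset.sum_nonneg fun m _ => mul_nonneg (ha0 m) (hβ0 _))
  have hg0 : ∀ n, 0 ≤ g n := fun n =>
    mul_nonneg hKn (Finset.sum_nonneg fun m _ => mul_nonneg (hb0 m) (hα0 _))
  have hpt : ∀ n, blockSup (M * M') n * bracket n ^ s ≤ f n + g n := by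
    intro n
    have hn : 0 < bracket n ^ s := Real.rpow_pos_of_pos (bracket_pos n) s
    rw [← le_div_iff₀ hn]
    refine blockSup_le (div_nonneg (add_nonneg (hf0 n) (hg0 n)) hn.le) fun x z hxz => ?_
    rw [le_div_iff₀ hn, block_mul]
    have h1 : opNorm (∑ y, block M x y * block M' y z) ≤
        ∑ y : {n // n ∈ A}, a (siteSub x.1 y.1) * b (siteSub y.1 z.1) :=
      (opNorm_sum_le _ _).trans <| Finset.sum_le_sum fun y _ => (opNorm_mul_le _ _).trans <|
        mul_le_mul (opNorm_block_le_blockSup M x y) (opNorm_block_le_blockSup M' y z)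
          (opNorm_nonneg _) (ha0 _)
    -- For fixed `x - z = n` the intermediate site `y` is determined by `x - y`, so the sum over `y`
    -- is part of a lattice convolution, to which Young's inequality applies.
    have hf' : ∑ y : {n // n ∈ A}, a (siteSub x.1 y.1) * β (siteSub y.1 z.1) ≤
        ∑ m ∈ T, a m * β (n - m) := by
      have : ∀ y : {n // n ∈ A}, siteSub y.1 z.1 = n - siteSub x.1 y.1 := fun y => by
        rw [← hxz, ← siteSub_add_siteSub x.1 y.1 z.1, add_sub_cancel_left]
      simp_rw [this]
      rw [← Finset.sum_image (f := fun m => a m * β (n - m))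
        (g := fun y : {n // n ∈ A} => siteSub x.1 y.1)
        fun y _ z _ h => Subtype.ext (siteSub_right_injective x.1 h)]
      refine Finset.sum_le_sum_of_subset_of_nonneg ?_ fun m _ _ => mul_nonneg (ha0 m) (hβ0 _)
      intro m hm
      obtain ⟨y, -, rfl⟩ := Finset.mem_image.1 hm
      exact siteSub_mem_diffSet x y
    have hg' : ∑ y : {n // n ∈ A}, b (siteSub y.1 z.1) * α (siteSub x.1 y.1) ≤
        ∑ m ∈ T', b m * α (n - m) := by
      have : ∀ y : {n // n ∈ A}, siteSub x.1 y.1 = n - siteSub y.1 z.1 := fun y => by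
        rw [← hxz, ← siteSub_add_siteSub x.1 y.1 z.1, add_sub_cancel_right]
      simp_rw [this]
      rw [← Finset.sum_image (f := fun m => b m * α (n - m))
        (g := fun y : {n // n ∈ A} => siteSub y.1 z.1)
        fun y _ w _ h => Subtype.ext (siteSub_left_injective z.1 h)]
      refine Finset.sum_le_sum_of_subset_of_nonneg ?_ fun m _ _ => mul_nonneg (hb0 m) (hα0 _)
      intro m hm
      obtain ⟨y, -, rfl⟩ := Finset.mem_image.1 hm
      exact siteSub_mem_diffSet y z
    calc _ ≤ (∑ y : {n // n ∈ A}, a (siteSub x.1 y.1) * b (siteSub y.1 z.1)) * bracket n ^ s :=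
          mul_le_mul_of_nonneg_right h1 hn.le
      _ ≤ ∑ y : {n // n ∈ A}, (2 * (a (siteSub x.1 y.1) * β (siteSub y.1 z.1)) +
            K * (b (siteSub y.1 z.1) * α (siteSub x.1 y.1))) := by
          rw [Finset.sum_mul]
          refine Finset.sum_le_sum fun y _ => ?_
          have h2 := hw (siteSub x.1 y.1) (siteSub y.1 z.1)
          rw [siteSub_add_siteSub, hxz] at h2
          refine (mul_le_mul_of_nonneg_left h2 (mul_nonneg (ha0 _) (hb0 _))).trans (le_of_eq ?_)
          simp only [hα, hβ]; ring
      _ ≤ _ := by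
          rw [Finset.sum_add_distrib, ← Finset.mul_sum, ← Finset.mul_sum]
          exact add_le_add (mul_le_mul_of_nonneg_left hf' zero_le_two)
            (mul_le_mul_of_nonneg_left hg' hKn)
  refine (sNorm_le_of_sum hK'.le fun k _ => hpt k).trans ?_
  refine (mul_le_mul_of_nonneg_left (sqrt_sum_add_sq_le _ _ _) (Real.sqrt_nonneg _)).trans ?_
  have hsq : ∀ (c p Z : ℝ), 0 ≤ c → 0 ≤ p → √K₀ * √(c ^ 2 * (p ^ 2 * (Z ^ 2 / K₀))) = c * p * |Z| := by
    intro c p Z hc hp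
    rw [← Real.sqrt_mul hK'.le, show K₀ * (c ^ 2 * (p ^ 2 * (Z ^ 2 / K₀))) = (c * p * Z) ^ 2 by
      field_simp, Real.sqrt_sq_eq_abs, abs_mul, abs_of_nonneg (mul_nonneg hc hp)]
  have hfb : √K₀ * √(∑ n ∈ diffSet C B, f n ^ 2) ≤ sNorm K₀ s₀ M * sNorm K₀ s M' := by
    have h1 : ∑ n ∈ diffSet C B, f n ^ 2 ≤
        2 ^ 2 * ((∑ m ∈ T, a m) ^ 2 * (sNorm K₀ s M' ^ 2 / K₀)) := by
      simp only [hf, mul_pow]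
      rw [← Finset.mul_sum]
      exact mul_le_mul_of_nonneg_left
        (sum_sq_sum_mul_sub_le T _ a β ha0 fun V => sum_sq_le_of_sNorm hK' s M' V) (by norm_num)
    refine (mul_le_mul_of_nonneg_left (Real.sqrt_le_sqrt h1) (Real.sqrt_nonneg _)).trans ?_
    rw [hsq _ _ _ zero_le_two (Finset.sum_nonneg fun m _ => ha0 m),
      abs_of_nonneg (sNorm_nonneg _ _ _)]
    refine mul_le_mul_of_nonneg_right ?_ (sNorm_nonneg _ _ _)
    linarith [sum_blockSup_le hs₀ hK₀ M T]
  have hgb : √K₀ * √(∑ n ∈ diffSet C B, g n ^ 2) ≤ K * sNorm K₀ s M * sNorm K₀ s₀ M' := by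
    have h1 : ∑ n ∈ diffSet C B, g n ^ 2 ≤
        K ^ 2 * ((∑ m ∈ T', b m) ^ 2 * (sNorm K₀ s M ^ 2 / K₀)) := by
      simp only [hg, mul_pow]
      rw [← Finset.mul_sum]
      exact mul_le_mul_of_nonneg_left
        (sum_sq_sum_mul_sub_le T' _ b α hb0 fun V => sum_sq_le_of_sNorm hK' s M V) (sq_nonneg _)
    refine (mul_le_mul_of_nonneg_left (Real.sqrt_le_sqrt h1) (Real.sqrt_nonneg _)).trans ?_
    rw [hsq _ _ _ hKn (Finset.sum_nonneg fun m _ => hb0 m),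
      abs_of_nonneg (sNorm_nonneg _ _ _), mul_assoc, mul_assoc]
    refine mul_le_mul_of_nonneg_left ?_ hKn
    rw [mul_comm]
    refine mul_le_mul_of_nonneg_left ?_ (sNorm_nonneg _ _ _)
    linarith [sum_blockSup_le hs₀ hK₀ M' T', sNorm_nonneg K₀ s₀ M']
  rw [mul_add]
  exact add_le_add hfb hgb

end Algebra

end Multiscale

/-! ### Neumann inversion and tame estimates in the abstract -/

namespace Multiscale

/-- A norm `p` and a higher norm `q` on square matrices, with a tame product estimate. -/
structure TamePair {n : Type*} [Fintype n] [DecidableEq n] (p q : Matrix n n ℂ → ℝ) (κ K : ℝ) :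
    Prop where
  one_le : 1 ≤ κ
  le : κ ≤ K
  nonneg : ∀ M, 0 ≤ p M
  nonneg' : ∀ M, 0 ≤ q M
  eq_zero : ∀ M, p M = 0 → M = 0
  neg : ∀ M, p (-M) = p M
  neg' : ∀ M, q (-M) = q M
  add_le : ∀ M M', p (M + M') ≤ p M + p M'
  add_le' : ∀ M M', q (M + M') ≤ q M + q M'
  mul_le : ∀ M M', p (M * M') ≤ κ * p M * p M'
  mul_le' : ∀ M M', q (M * M') ≤ κ * p M * q M' + K * q M * p M'

namespace TamePair

variable {n : Type*} [Fintype n] [DecidableEq n] {p q : Matrix n n ℂ → ℝ} {κ K : ℝ}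

/-- A kernel vector `v` of `1 + H` gives the rank-one matrix `Z = v vᵀ` with `Z = -H Z`, whence `p Z
≤ p Z / 2`. Passing to a square matrix is needed because `p` does not measure vectors. -/
theorem isUnit_one_add (h : TamePair p q κ K) {H : Matrix n n ℂ} (hH : κ * p H ≤ 1 / 2) :
    IsUnit (1 + H) := by
  rw [Matrix.isUnit_iff_isUnit_det, isUnit_iff_ne_zero]
  intro hdet
  obtain ⟨v, hv, hv0⟩ := Matrix.exists_mulVec_eq_zero_iff.2 hdet
  obtain ⟨i, hi⟩ := Function.ne_iff.1 hv
  have hZ : Matrix.vecMulVec v v = -(H * Matrix.vecMulVec v v) := by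
    have : (1 + H) * Matrix.vecMulVec v v = 0 := by
      rw [Matrix.mul_vecMulVec, hv0, Matrix.zero_vecMulVec]
    rw [add_mul, one_mul] at this
    exact eq_neg_of_add_eq_zero_left this
  have h0 : Matrix.vecMulVec v v = 0 := by
    refine h.eq_zero _ (le_antisymm ?_ (h.nonneg _))
    have h1 : p (Matrix.vecMulVec v v) ≤ κ * p H * p (Matrix.vecMulVec v v) := by
      conv_lhs => rw [hZ, h.neg]
      exact h.mul_le _ _
    nlinarith [h.nonneg (Matrix.vecMulVec v v)]
  have := congrFun (congrFun h0 i) i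
  simp [Matrix.vecMulVec_apply] at this
  exact hi this

theorem le_two_mul (h : TamePair p q κ K) {H Y V : Matrix n n ℂ} (hH : κ * p H ≤ 1 / 2)
    (hY : Y = V - H * Y) : p Y ≤ 2 * p V := by
  have h1 : p Y ≤ p V + κ * p H * p Y := by
    conv_lhs => rw [hY, sub_eq_add_neg]
    refine (h.add_le _ _).trans ?_
    rw [h.neg]
    exact add_le_add le_rfl (h.mul_le _ _)
  nlinarith [h.nonneg Y]

/-- The term to be absorbed, `κ * p H * q Y`, involves `κ` only; the large constant `K` multiplies
the already controlled `p Y`. Hence one smallness condition serves all higher norms. -/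
theorem le_two_mul' (h : TamePair p q κ K) {H Y V : Matrix n n ℂ} (hH : κ * p H ≤ 1 / 2)
    (hY : Y = V - H * Y) : q Y ≤ 2 * q V + 4 * K * q H * p V := by
  have h1 : q Y ≤ q V + (κ * p H * q Y + K * q H * p Y) := by
    conv_lhs => rw [hY, sub_eq_add_neg]
    refine (h.add_le' _ _).trans ?_
    rw [h.neg']
    exact add_le_add le_rfl (h.mul_le' _ _)
  have h2 : K * q H * p Y ≤ K * q H * (2 * p V) :=
    mul_le_mul_of_nonneg_left (h.le_two_mul hH hY)
      (mul_nonneg (by linarith [h.one_le, h.le]) (h.nonneg' H))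
  nlinarith [h.nonneg' Y]

theorem mul_bound (h : TamePair p q κ K) {M M' : Matrix n n ℂ} {α β α' β' : ℝ} (h1 : p M ≤ α)
    (h2 : q M ≤ β) (h3 : p M' ≤ α') (h4 : q M' ≤ β') :
    p (M * M') ≤ K * (α * α') ∧ q (M * M') ≤ K * (α * β' + β * α') := by
  have hK : 0 ≤ K := by linarith [h.one_le, h.le]
  have hκ : 0 ≤ κ := by linarith [h.one_le]
  have p1 := h.nonneg M
  have p2 := h.nonneg M'
  have q1 := h.nonneg' M
  have q2 := h.nonneg' M'
  have hα : 0 ≤ α := p1.trans h1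
  have hβ : 0 ≤ β := q1.trans h2
  have := h.le
  constructor
  · calc _ ≤ κ * p M * p M' := h.mul_le _ _
      _ ≤ K * α * α' := by gcongr
      _ = _ := by ring
  · calc _ ≤ κ * p M * q M' + K * q M * p M' := h.mul_le' _ _
      _ ≤ K * α * β' + K * β * α' := by gcongr
      _ = _ := by ring

theorem add_bound (h : TamePair p q κ K) {M M' : Matrix n n ℂ} {α β α' β' : ℝ} (h1 : p M ≤ α)
    (h2 : q M ≤ β) (h3 : p M' ≤ α') (h4 : q M' ≤ β') :
    p (M + M') ≤ α + α' ∧ q (M + M') ≤ β + β' :=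
  ⟨(h.add_le _ _).trans (add_le_add h1 h3), (h.add_le' _ _).trans (add_le_add h2 h4)⟩

theorem sub_bound (h : TamePair p q κ K) {M M' : Matrix n n ℂ} {α β α' β' : ℝ} (h1 : p M ≤ α)
    (h2 : q M ≤ β) (h3 : p M' ≤ α') (h4 : q M' ≤ β') :
    p (M - M') ≤ α + α' ∧ q (M - M') ≤ β + β' := by
  rw [sub_eq_add_neg]
  exact h.add_bound h1 h2 ((h.neg M').trans_le h3) ((h.neg' M').trans_le h4)

/-- Monotonicity of monomials in quantities that are at least `1`. -/
theorem monomial_le {x y z w : ℝ} (hx : 1 ≤ x) (hy : 1 ≤ y) (hz : 1 ≤ z) (hw : 1 ≤ w)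
    {i i' j j' k k' l l' : ℕ} (hi : i ≤ i') (hj : j ≤ j') (hk : k ≤ k') (hl : l ≤ l') :
    x ^ i * y ^ j * z ^ k * w ^ l ≤ x ^ i' * y ^ j' * z ^ k' * w ^ l' := by
  gcongr

/-- Estimates for the elimination of the good sites. -/
theorem elimination_bounds (h : TamePair p q κ K) {X Γ Γ' L A' πB π' : Matrix n n ℂ} {c E g : ℝ}
    (hc : 1 ≤ c) (hE : 1 ≤ E) (hg : 1 ≤ g)
    (hX : X = 1 - Γ' * X) (hΓ's : κ * p Γ' ≤ 1 / 2) (hΓ' : q Γ' ≤ c * (E * g))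
    (hΓs : p Γ ≤ c) (hΓ : q Γ ≤ c * (E * g)) (hLs : p L ≤ c * E) (hL : q L ≤ c * (E * g))
    (h1s : p 1 ≤ c) (h1 : q 1 ≤ c) (hBs : p πB ≤ c) (hB : q πB ≤ c) (hπs : p π' ≤ c)
    (hπ : q π' ≤ c) (hAs : p A' ≤ c) (hA : q A' ≤ c * g) :
    (p ((1 - X * Γ) * πB) ≤ 20 * K ^ 4 * c ^ 5 ∧
      q ((1 - X * Γ) * πB) ≤ 20 * K ^ 4 * c ^ 5 * (E * g)) ∧
    q (A' * ((1 - X * Γ) * πB)) ≤ 20 * K ^ 4 * c ^ 5 * (E * g) ∧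
    (p (X * L) ≤ 20 * K ^ 4 * c ^ 5 * E ∧ q (X * L) ≤ 20 * K ^ 4 * c ^ 5 * (E ^ 2 * g)) ∧
    (p (π' - A' * (X * L)) ≤ 20 * K ^ 4 * c ^ 5 * E ∧
      q (π' - A' * (X * L)) ≤ 20 * K ^ 4 * c ^ 5 * (E ^ 2 * g)) := by
  have hK : 1 ≤ K := h.one_le.trans h.le
  -- All monomials that occur are majorized by a single one, which explains the crude common
  -- constant `20 * K ^ 4 * c ^ 5`.
  have m : ∀ (i j k l i' j' k' l' : ℕ), i ≤ i' ∧ j ≤ j' ∧ k ≤ k' ∧ l ≤ l' →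
      K ^ i * c ^ j * E ^ k * g ^ l ≤ K ^ i' * c ^ j' * E ^ k' * g ^ l' :=
    fun i j k l i' j' k' l' ⟨hi, hj, hk, hl⟩ => monomial_le hK hc hE hg hi hj hk hl
  have hXs : p X ≤ 2 * c := (h.le_two_mul hΓ's hX).trans (by linarith)
  have hXq : q X ≤ 6 * K * c ^ 2 * (E * g) := by
    refine (h.le_two_mul' hΓ's hX).trans ?_
    calc _ ≤ 2 * c + 4 * K * (c * (E * g)) * c := by
          gcongr
          exact h.nonneg _
      _ ≤ _ := by linarith [m 0 1 0 0 1 2 1 1 (by decide)]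
  obtain ⟨a1, a2⟩ := h.mul_bound hXs hXq hΓs hΓ
  obtain ⟨b1, b2⟩ := h.sub_bound h1s h1 a1 a2
  obtain ⟨d1, d2⟩ := h.mul_bound b1 b2 hBs hB
  have d1' : p ((1 - X * Γ) * πB) ≤ 3 * K ^ 2 * c ^ 3 :=
    d1.trans (by linarith [m 1 2 0 0 2 3 0 0 (by decide)])
  have d2' : q ((1 - X * Γ) * πB) ≤ 12 * K ^ 3 * c ^ 4 * (E * g) :=
    d2.trans <| by
      linarith [m 1 2 0 0 3 4 1 1 (by decide), m 2 3 0 0 3 4 1 1 (by decide),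
        m 2 3 1 1 3 4 1 1 (by decide)]
  obtain ⟨-, e2⟩ := h.mul_bound hAs hA d1' d2'
  obtain ⟨f1, f2⟩ := h.mul_bound hXs hXq hLs hL
  have f2' : q (X * L) ≤ 8 * K ^ 2 * c ^ 3 * (E ^ 2 * g) :=
    f2.trans (by linarith [m 1 2 1 1 2 3 2 1 (by decide)])
  obtain ⟨g1, g2⟩ := h.mul_bound hAs hA f1 f2'
  obtain ⟨i1, i2⟩ := h.sub_bound hπs hπ g1 g2
  have n1 := m 0 0 0 0 4 5 0 0 (by decide)
  have n2 := m 0 0 0 0 4 5 1 0 (by decide)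
  have n3 := m 0 0 0 0 4 5 1 1 (by decide)
  have n4 := m 0 0 0 0 4 5 2 1 (by decide)
  refine ⟨⟨d1'.trans ?_, d2'.trans ?_⟩, e2.trans ?_, ⟨f1.trans ?_, f2'.trans ?_⟩,
    i1.trans ?_, i2.trans ?_⟩
  · linarith [m 2 3 0 0 4 5 0 0 (by decide)]
  · linarith [m 3 4 1 1 4 5 1 1 (by decide)]
  · linarith [m 3 4 0 1 4 5 1 1 (by decide)]
  · linarith [m 1 2 1 0 4 5 1 0 (by decide)]
  · linarith [m 2 3 2 1 4 5 2 1 (by decide)]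
  · linarith [m 0 1 0 0 4 5 1 0 (by decide), m 2 3 1 0 4 5 1 0 (by decide)]
  · linarith [m 0 1 0 0 4 5 2 1 (by decide), m 3 4 2 1 4 5 2 1 (by decide),
      m 2 3 1 1 4 5 2 1 (by decide)]

/-- Estimates for the left inverse on the bad sites and for the full inverse. -/
theorem inverse_bound (h : TamePair p q κ K) {Y V R Ñ W S : Matrix n n ℂ} {c a E g : ℝ}
    (hc : 1 ≤ c) (ha : 1 ≤ a) (hE : 1 ≤ E) (hg : 1 ≤ g)
    (hY : Y = V - V * R * Y) (hs : κ * p (V * R) ≤ 1 / 2)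
    (hVs : p V ≤ c * a) (hV : q V ≤ c * (a * g)) (hRs : p R ≤ 1) (hR : q R ≤ c * (E * g))
    (hNs : p Ñ ≤ c) (hN : q Ñ ≤ c * (E * g)) (hW : q W ≤ c * (E ^ 2 * g)) (hSs : p S ≤ c * E)
    (hS : q S ≤ c * (E ^ 2 * g)) :
    q (W + Ñ * (Y * S)) ≤ 20 * K ^ 4 * c ^ 5 * (a ^ 2 * E ^ 2 * g) := by
  have hK : 1 ≤ K := h.one_le.trans h.le
  have m : ∀ (i j k l i' j' k' l' : ℕ), i ≤ i' ∧ j ≤ j' ∧ k ≤ k' ∧ l ≤ l' →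
      g * (K ^ i * c ^ j * a ^ k * E ^ l) ≤ g * (K ^ i' * c ^ j' * a ^ k' * E ^ l') :=
    fun i j k l i' j' k' l' ⟨hi, hj, hk, hl⟩ =>
      mul_le_mul_of_nonneg_left (monomial_le hK hc ha hE hi hj hk hl) (by linarith)
  obtain ⟨-, a2⟩ := h.mul_bound hVs hV hRs hR
  have a2' : q (V * R) ≤ 2 * K * c ^ 2 * (a * E * g) :=
    a2.trans (by linarith [m 1 1 1 0 1 2 1 1 (by decide)])
  have hYs : p Y ≤ 2 * (c * a) := (h.le_two_mul hs hY).trans (by linarith)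
  have hYq : q Y ≤ 10 * K ^ 2 * c ^ 3 * (a ^ 2 * E * g) := by
    refine (h.le_two_mul' hs hY).trans ?_
    calc _ ≤ 2 * (c * (a * g)) + 4 * K * (2 * K * c ^ 2 * (a * E * g)) * (c * a) := by
          gcongr
          exact h.nonneg _
      _ ≤ _ := by linarith [m 0 1 1 0 2 3 2 1 (by decide)]
  obtain ⟨b1, b2⟩ := h.mul_bound hYs hYq hSs hS
  have b2' : q (Y * S) ≤ 12 * K ^ 3 * c ^ 4 * (a ^ 2 * E ^ 2 * g) :=
    b2.trans (by linarith [m 1 2 1 2 3 4 2 2 (by decide)])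
  obtain ⟨-, d2⟩ := h.mul_bound hNs hN b1 b2'
  refine ((h.add_le' _ _).trans (add_le_add hW d2)).trans ?_
  linarith [m 0 0 0 0 4 5 2 2 (by decide), m 0 1 0 2 4 5 2 2 (by decide),
    m 2 3 1 2 4 5 2 2 (by decide)]

end TamePair

/-! ### Ring identities behind the elimination -/

section Identities

variable {R : Type*} [Ring R] {a a' l x γ πB π' : R}

/-- The factor `1 + γ * (1 - πB)` fixes `πB` under right multiplication by `πB`, hence so does its
inverse: `x * πB = πB`. Applying `x` to `hl` then gives the decomposition. -/
theorem one_eq_of_elimination (hx : x * (1 + γ * (1 - πB)) = 1) (hl : l * a = 1 - πB + γ)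
    (hB : πB * πB = πB) : 1 = x * l * a + (1 - x * γ) * πB := by
  have h1 : x * πB = πB := by
    have : x * (1 + γ * (1 - πB)) * πB = x * πB := by
      rw [mul_assoc, add_mul, mul_assoc γ, sub_mul, one_mul, hB, sub_self, mul_zero, add_zero]
    rw [← this, hx, one_mul]
  have h2 : x + x * γ * (1 - πB) = 1 :=
    Eq.trans (by noncomm_ring) hx
  have : x * l * a = x - πB + x * γ := by
    rw [mul_assoc, hl, mul_add, mul_sub, mul_one, h1]
  calc (1 : R) = x + x * γ * (1 - πB) := h2.symm
    _ = _ := by rw [this]; noncomm_ring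

/-- Write `l * a = (1 + γ * (1 - πB)) - (1 - γ) * πB`. The last term vanishes against `x * l`,
because `πB * x = πB` and `πB * l = 0`; what remains is `l * a * x * l = l`. -/
theorem left_mul_schur_eq_zero (hx : (1 + γ * (1 - πB)) * x = 1) (hl : l * a = 1 - πB + γ)
    (hBl : πB * l = 0) (hBγ : πB * γ = 0) : l * (1 - a * (x * l)) = 0 := by
  have h1 : πB * x = πB := by
    have : πB * ((1 + γ * (1 - πB)) * x) = πB * x := by
      rw [← mul_assoc, mul_add, ← mul_assoc, hBγ, zero_mul, add_zero, mul_one]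
    rw [← this, hx, mul_one]
  have h2 : l * a = (1 + γ * (1 - πB)) - (1 - γ) * πB := by rw [hl]; noncomm_ring
  have h3 : l * (a * (x * l)) = (1 + γ * (1 - πB)) * x * l - (1 - γ) * (πB * x * l) := by
    rw [← mul_assoc, h2]; noncomm_ring
  rw [mul_sub, mul_one, h3, hx, h1, hBl, one_mul, mul_zero, sub_zero, sub_self]

end Identities

end Multiscale

/-! ### Block diagonal matrices, masks, and rows of local inverses -/

namespace Multiscale

variable {ν r : ℕ} {dim : (Fin r → ℕ) → ℕ} {A B C F : Finset (Site ν r)}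

section OpNorm

open scoped Matrix.Norms.L2Operator

theorem opNorm_smul {m n : Type*} [Fintype m] [Fintype n] [DecidableEq n] (c : ℂ)
    (M : Matrix m n ℂ) : opNorm (c • M) = ‖c‖ * opNorm M := norm_smul c M

end OpNorm

/-- The block-diagonal matrix with scalar diagonal blocks `c_𝔫 I`. -/
def siteDiag (c : {n // n ∈ A} → ℂ) : BlockMat dim A A := Matrix.diagonal fun i => c i.1

theorem block_siteDiag_self (c : {n // n ∈ A} → ℂ) (x) :
    block (siteDiag c : BlockMat dim A A) x x = c x • (1 : Matrix _ _ ℂ) := by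
  ext p q
  by_cases h : p = q <;> simp [block, siteDiag, Matrix.diagonal_apply, h]

theorem block_siteDiag_ne (c : {n // n ∈ A} → ℂ) {x y} (h : x ≠ y) :
    block (siteDiag c : BlockMat dim A A) x y = 0 := by
  ext p q
  simp [block, siteDiag, h]

theorem block_siteDiag_mul (c : {n // n ∈ A} → ℂ) (M : BlockMat dim A A) (x y) :
    block (siteDiag c * M) x y = c x • block M x y := by
  ext p q
  simp [block, siteDiag, Matrix.diagonal_mul]

theorem block_mul_siteDiag (c : {n // n ∈ A} → ℂ) (M : BlockMat dim A A) (x y) :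
    block (M * siteDiag c) x y = c y • block M x y := by
  ext p q
  simp [block, siteDiag, Matrix.mul_diagonal, mul_comm]

theorem siteDiag_one : (siteDiag (fun _ => 1) : BlockMat dim A A) = 1 := Matrix.diagonal_one

theorem siteDiag_mul_siteDiag (c c' : {n // n ∈ A} → ℂ) :
    (siteDiag c * siteDiag c' : BlockMat dim A A) = siteDiag fun n => c n * c' n :=
  Matrix.diagonal_mul_diagonal _ _

theorem siteDiag_sub (c c' : {n // n ∈ A} → ℂ) :
    (siteDiag c - siteDiag c' : BlockMat dim A A) = siteDiag fun n => c n - c' n :=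
  Matrix.diagonal_sub _ _

theorem block_one_self (x : {n // n ∈ A}) :
    block (1 : BlockMat dim A A) x x = (1 : Matrix _ _ ℂ) := by
  rw [← siteDiag_one, block_siteDiag_self, one_smul]

theorem block_one_ne {x y : {n // n ∈ A}} (h : x ≠ y) : block (1 : BlockMat dim A A) x y = 0 := by
  rw [← siteDiag_one, block_siteDiag_ne _ h]

theorem block_sub (M M' : BlockMat dim C B) (n' n'') :
    block (M - M') n' n'' = block M n' n'' - block M' n' n'' := rfl

theorem block_zero (x : {n // n ∈ C}) (y : {n // n ∈ B}) :
    block (0 : BlockMat dim C B) x y = 0 := rfl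

theorem block_offDiag_self (M : BlockMat dim A A) (x) : block (M - blockDiag M) x x = 0 := by
  ext p q; simp [block, blockDiag]

theorem block_offDiag_ne (M : BlockMat dim A A) {x y} (h : x ≠ y) :
    block (M - blockDiag M) x y = block M x y := by
  ext p q; simp [block, blockDiag, h]

/-- The constant of the decay criterion `sNorm_le_of_decay` with loss `ν + r`. -/
noncomputable def decayConst (ν r : ℕ) (K₀ : ℝ) : ℝ :=
  √(K₀ * ∑' k : LatticePt ν r, bracket k ^ (-(2 * ((ν : ℝ) + r))))

theorem decayConst_nonneg (K₀ : ℝ) : 0 ≤ decayConst ν r K₀ := Real.sqrt_nonneg _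

/-- Blockwise bounds pass from individual rows to the assembled matrix, at the price of `ν + r`
units of decay. The constant depends neither on `s` nor on the index sets, and `ν ≥ 1` makes its
series converge. -/
theorem sNorm_le_decayConst_mul (hν : 1 ≤ ν) {K₀ : ℝ} (hK : 0 ≤ K₀) {s X : ℝ} (hX : 0 ≤ X)
    {M : BlockMat dim C B}
    (h : ∀ x y, opNorm (block M x y) ≤ X * bracket (siteSub x.1 y.1) ^ (-(s + ((ν : ℝ) + r)))) :
    sNorm K₀ s M ≤ decayConst ν r K₀ * X := by
  have hν' : (1 : ℝ) ≤ ν := by exact_mod_cast hν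
  have hr' : (0 : ℝ) ≤ r := Nat.cast_nonneg r
  exact sNorm_le_of_decay hK (by linarith) hX h

theorem sNorm_siteDiag_le (hν : 1 ≤ ν) {K₀ : ℝ} (hK : 0 ≤ K₀) (s : ℝ) {X : ℝ} (hX : 0 ≤ X)
    {c : {n // n ∈ A} → ℂ} (hc : ∀ x, ‖c x‖ ≤ X) :
    sNorm K₀ s (siteDiag c : BlockMat dim A A) ≤ decayConst ν r K₀ * X := by
  refine sNorm_le_decayConst_mul hν hK hX fun x y => ?_
  by_cases h : x = y
  · subst h
    rw [block_siteDiag_self, siteSub_self, bracket_zero, Real.one_rpow, mul_one]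
    exact (opNorm_smul_one_le _).trans (hc x)
  · rw [block_siteDiag_ne _ h, opNorm_zero]
    exact mul_nonneg hX (bracket_rpow_nonneg _ _)

theorem sNorm_mul_siteDiag_le {K₀ : ℝ} (hK : 0 ≤ K₀) (s : ℝ) {c : {n // n ∈ A} → ℂ}
    (hc : ∀ x, ‖c x‖ ≤ 1) (M : BlockMat dim A A) : sNorm K₀ s (M * siteDiag c) ≤ sNorm K₀ s M :=
  sNorm_mono_of_block hK s fun x y => by
    rw [block_mul_siteDiag, opNorm_smul]
    exact mul_le_of_le_one_left (opNorm_nonneg _) (hc y)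

theorem sNorm_siteDiag_mul_le {K₀ : ℝ} (hK : 0 ≤ K₀) (s : ℝ) {c : {n // n ∈ A} → ℂ}
    (hc : ∀ x, ‖c x‖ ≤ 1) (M : BlockMat dim A A) : sNorm K₀ s (siteDiag c * M) ≤ sNorm K₀ s M :=
  sNorm_mono_of_block hK s fun x y => by
    rw [block_siteDiag_mul, opNorm_smul]
    exact mul_le_of_le_one_left (opNorm_nonneg _) (hc x)

open scoped Classical in
/-- The matrix `M` with the blocks outside a set of pairs of sites replaced by `0`. -/
noncomputable def blockMask (Φ : {n // n ∈ C} → {n // n ∈ B} → Prop) (M : BlockMat dim C B) :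
    BlockMat dim C B :=
  Matrix.of fun i j => if Φ i.1 j.1 then M i j else 0

theorem block_blockMask_of_pos {Φ : {n // n ∈ C} → {n // n ∈ B} → Prop} (M : BlockMat dim C B)
    {x y} (h : Φ x y) : block (blockMask Φ M) x y = block M x y := by
  ext p q; simp [block, blockMask, h]

theorem block_blockMask_of_neg {Φ : {n // n ∈ C} → {n // n ∈ B} → Prop} (M : BlockMat dim C B)
    {x y} (h : ¬ Φ x y) : block (blockMask Φ M) x y = 0 := by
  ext p q; simp [block, blockMask, h]

theorem opNorm_block_blockMask_le (Φ : {n // n ∈ C} → {n // n ∈ B} → Prop) (M : BlockMat dim C B)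
    (x y) : opNorm (block (blockMask Φ M) x y) ≤ opNorm (block M x y) := by
  by_cases h : Φ x y
  · rw [block_blockMask_of_pos M h]
  · rw [block_blockMask_of_neg M h, opNorm_zero]; exact opNorm_nonneg _

/-- The matrix whose `𝔫`-th block row is the `𝔫`-th block row of `f 𝔫`. -/
def rowAssemble (f : {n // n ∈ A} → BlockMat dim A A) : BlockMat dim A A :=
  Matrix.of fun i j => f i.1 i j

theorem block_rowAssemble (f : {n // n ∈ A} → BlockMat dim A A) (x y) :
    block (rowAssemble f) x y = block (f x) x y := rfl

theorem rowAssemble_mul (f : {n // n ∈ A} → BlockMat dim A A) (M : BlockMat dim A A) :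
    rowAssemble f * M = rowAssemble fun x => f x * M := rfl

/-- Extension by zero of a matrix on `𝔉 ⊆ 𝔄`. -/
def extendMat (A : Finset (Site ν r)) (M : BlockMat dim F F) : BlockMat dim A A :=
  Matrix.of fun i j =>
    if h : i.1.1 ∈ F ∧ j.1.1 ∈ F then M ⟨⟨i.1.1, h.1⟩, i.2⟩ ⟨⟨j.1.1, h.2⟩, j.2⟩ else 0

theorem block_extendMat_of_mem (M : BlockMat dim F F) {x y : {n // n ∈ A}} (hx : x.1 ∈ F)
    (hy : y.1 ∈ F) : block (extendMat A M) x y = block M ⟨x.1, hx⟩ ⟨y.1, hy⟩ := by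
  ext p q; simp [block, extendMat, hx, hy]

theorem block_extendMat_of_not_mem (M : BlockMat dim F F) {x y : {n // n ∈ A}}
    (h : ¬ (x.1 ∈ F ∧ y.1 ∈ F)) : block (extendMat A M) x y = 0 := by
  ext p q; simp only [block, extendMat, Matrix.of_apply, dif_neg h, Matrix.zero_apply]

theorem sNorm_extendMat_le {K₀ : ℝ} (hK : 0 ≤ K₀) (s : ℝ) (M : BlockMat dim F F) :
    sNorm K₀ s (extendMat A M) ≤ sNorm K₀ s M := by
  have := sNorm_le_mul_sNorm hK (s := s) (s' := s) zero_le_one (M := extendMat A M) (M' := M)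
    fun k => by
      rw [one_mul]
      refine mul_le_mul_of_nonneg_right (blockSup_le (blockSup_nonneg _ _) fun x y hxy => ?_)
        (bracket_rpow_nonneg _ _)
      by_cases h : x.1 ∈ F ∧ y.1 ∈ F
      · rw [block_extendMat_of_mem M h.1 h.2]
        exact hxy ▸ opNorm_block_le_blockSup M ⟨x.1, h.1⟩ ⟨y.1, h.2⟩
      · rw [block_extendMat_of_not_mem M h, opNorm_zero]
        exact blockSup_nonneg _ _
  simpa using this

theorem block_extendMat_mul_of_mem (h : F ⊆ A) (M : BlockMat dim F F) (M' : BlockMat dim A A)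
    {x y : {n // n ∈ A}} (hx : x.1 ∈ F) (hy : y.1 ∈ F) :
    block (extendMat A M * M') x y = block (M * restrict h M') ⟨x.1, hx⟩ ⟨y.1, hy⟩ := by
  rw [block_mul, block_mul]
  symm
  refine Fintype.sum_of_injective (fun m : {n // n ∈ F} => (⟨m.1, h m.2⟩ : {n // n ∈ A}))
    (fun a b hab => Subtype.ext (congrArg (fun z : {n // n ∈ A} => z.1) hab)) _ _
    (fun m hm => ?_) fun m => ?_
  · rw [block_extendMat_of_not_mem, Matrix.zero_mul]
    exact fun hF => hm ⟨⟨m.1, hF.2⟩, rfl⟩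
  · rw [block_extendMat_of_mem M hx m.2]; rfl

/-- Take for `f` the inverse on the window `F`, extended by zero. On columns in `F` row `x` of the
residual vanishes; on the other columns `f` only meets off-diagonal blocks of `M`, and these columns
are at distance at least `N` from `x`. -/
theorem exists_row_of_isScaleRegularSite {K₀ s₀ S τ₂ δ N : ℝ} (hK : 0 ≤ K₀) (hN : 0 < N)
    {M : BlockMat dim A A} {x : {n // n ∈ A}} (hx : IsScaleRegularSite K₀ s₀ S τ₂ δ N M x) :
    ∃ f : BlockMat dim A A,
      (∀ s ∈ Set.Icc s₀ S, sNorm K₀ s f ≤ N ^ (τ₂ + δ * s)) ∧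
      (∀ u v, block f u v ≠ 0 → siteDist u.1 v.1 ≤ 4 * N) ∧
      (∀ y, opNorm (block (f * M - 1) x y) ≤ opNorm (block (f * (M - blockDiag M)) x y)) ∧
      ∀ y, block (f * M - 1) x y ≠ 0 → N ≤ siteDist x.1 y.1 := by
  obtain ⟨F, hF, hdiam, hdist, -, hunit, hbd⟩ := hx
  have hxF : x.1 ∈ F := by
    by_contra hxF
    have := hdist x.1 (Finset.mem_singleton_self _) x.1 (Finset.mem_sdiff.2 ⟨x.2, hxF⟩)
    rw [siteDist_self] at this
    linarith
  set G := (restrict hF M)⁻¹ with hG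
  -- Inside the window the row of `f * M` is that of the inverse times the restricted matrix, hence
  -- of the identity.
  have hin : ∀ y : {n // n ∈ A}, y.1 ∈ F → block (extendMat A G * M - 1) x y = 0 := by
    intro y hy
    rw [block_sub, block_extendMat_mul_of_mem hF G M hxF hy, hG,
      Matrix.nonsing_inv_mul _ ((Matrix.isUnit_iff_isUnit_det _).1 hunit)]
    by_cases hxy : x = y
    · subst hxy
      rw [block_one_self, block_one_self, sub_self]
    · rw [block_one_ne hxy, block_one_ne, sub_zero]
      exact fun h => hxy (Subtype.ext (congrArg (fun z : {n // n ∈ F} => z.1) h))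
  have hout : ∀ y : {n // n ∈ A}, y.1 ∉ F → block (extendMat A G * M - 1) x y =
      block (extendMat A G * (M - blockDiag M)) x y := by
    intro y hy
    have hxy : x ≠ y := fun h => hy (h ▸ hxF)
    rw [block_sub, block_one_ne hxy, sub_zero, block_mul, block_mul]
    refine Finset.sum_congr rfl fun m _ => ?_
    by_cases hm : m.1 ∈ F
    · rw [block_offDiag_ne M fun h : m = y => hy (h ▸ hm)]
    · rw [block_extendMat_of_not_mem G fun h => hm h.2, Matrix.zero_mul, Matrix.zero_mul]
  refine ⟨extendMat A G, fun s hs => (sNorm_extendMat_le hK s G).trans (hbd s hs), ?_, ?_, ?_⟩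
  · intro u v huv
    by_cases h : u.1 ∈ F ∧ v.1 ∈ F
    · exact hdiam _ h.1 _ h.2
    · exact absurd (block_extendMat_of_not_mem G h) huv
  · intro y
    by_cases hy : y.1 ∈ F
    · rw [hin y hy, opNorm_zero]; exact opNorm_nonneg _
    · rw [hout y hy]
  · intro y hne
    by_cases hy : y.1 ∈ F
    · exact absurd (hin y hy) hne
    · exact hdist x.1 (Finset.mem_singleton_self _) y.1 (Finset.mem_sdiff.2 ⟨y.2, hy⟩)

theorem block_smul_one_mul_sub_one {M : BlockMat dim A A} {x : {n // n ∈ A}} {μ : ℂ} (hμ : μ ≠ 0)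
    (hx : block M x x = μ • (1 : Matrix _ _ ℂ)) (y) :
    block (siteDiag (fun _ => μ⁻¹) * M - 1) x y = μ⁻¹ • block (M - blockDiag M) x y := by
  rw [block_sub, block_siteDiag_mul]
  by_cases h : x = y
  · subst h
    rw [hx, block_offDiag_self, block_one_self, smul_smul, inv_mul_cancel₀ hμ, one_smul, sub_self,
      smul_zero]
  · rw [block_offDiag_ne M h, block_one_ne h, sub_zero]

/-- The strong norms form tame pairs; the constant `κ` does not depend on the range of `s`. -/
theorem exists_tamePair_sNorm {s₀ K₀ : ℝ} (hs₀ : (ν : ℝ) + r < 2 * s₀)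
    (hK₀ : 4 * ∑' k : LatticePt ν r, bracket k ^ (-(2 * s₀)) < K₀) :
    ∃ κ : ℝ, 1 ≤ κ ∧ ∀ t : ℝ, ∃ K : ℝ, κ ≤ K ∧ ∀ s ∈ Set.Icc s₀ t, ∀ A : Finset (Site ν r),
      TamePair (sNorm (dim := dim) (C := A) (B := A) K₀ s₀) (sNorm K₀ s) κ K := by
  have hpos : 0 ≤ s₀ := by
    have : (0 : ℝ) ≤ (ν : ℝ) + r := by positivity
    linarith
  have hK := four_lt_of_tsum_lt hs₀ hK₀
  obtain ⟨k₀, hk₀, hw₀⟩ := exists_bracket_rpow_add_le (ν := ν) (r := r) s₀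
  refine ⟨1 + k₀, by linarith, fun t => ?_⟩
  obtain ⟨k, hk, hw⟩ := exists_bracket_rpow_add_le (ν := ν) (r := r) t
  refine ⟨1 + k₀ + k, by linarith, fun s hs A => ?_⟩
  refine ⟨by linarith, by linarith, sNorm_nonneg _ _, sNorm_nonneg _ _, fun M hM => ?_,
    sNorm_neg _ _, sNorm_neg _ _, sNorm_add_le (by linarith) _, sNorm_add_le (by linarith) _,
    fun M M' => ?_, fun M M' => ?_⟩
  · refine eq_of_block_eq fun x y => ?_
    have := opNorm_block_le_sNorm (K₀ := K₀) (by linarith) s₀ M x y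
    rw [hM, zero_mul] at this
    rw [block_zero]
    exact opNorm_eq_zero.1 (le_antisymm this (opNorm_nonneg _))
  · refine (sNorm_mul_le_of_weight hs₀ hK₀ hk₀ (hw₀ s₀ hpos le_rfl) M M').trans (le_of_eq ?_)
    ring
  · refine (sNorm_mul_le_of_weight hs₀ hK₀ hk (hw s (hpos.trans hs.1) hs.2) M M').trans ?_
    have h1 := mul_nonneg hk₀ (mul_nonneg (sNorm_nonneg K₀ s₀ M) (sNorm_nonneg K₀ s M'))
    have h2 := mul_nonneg (by linarith : 0 ≤ 1 + k₀)
      (mul_nonneg (sNorm_nonneg K₀ s M) (sNorm_nonneg K₀ s₀ M'))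
    nlinarith

end Multiscale

/-! ### Decay of the rows at good sites -/

namespace Multiscale

variable {ν r : ℕ} {dim : (Fin r → ℕ) → ℕ} {A : Finset (Site ν r)}

/-- The block row of an approximate left inverse at a regular site, with its decay. -/
theorem row_of_regular {K₀ s₀ S s₂ τ₂ δ Θ N κ K Υ c : ℝ} (hK₀ : 1 ≤ K₀)
    (hs₀ : 0 ≤ s₀) (hS : s₀ + (ν + r) ≤ S) (hSs₂ : S ≤ s₂)
    (hτ₂ : 0 ≤ τ₂) (hΘ : 1 ≤ Θ) (hN : 1 ≤ N) (hΥ : 0 ≤ Υ)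
    (hT : ∀ s ∈ Set.Icc s₀ (s₂ + (ν + r)),
      TamePair (sNorm (dim := dim) (C := A) (B := A) K₀ s₀) (sNorm K₀ s) κ K)
    (hc : 4 ^ (s₂ + (ν + r)) * (2 * (K * (1 + Υ))) ≤ c)
    {M : BlockMat dim A A} (hQ : sNorm K₀ S (M - blockDiag M) ≤ Υ)
    {x : {n // n ∈ A}} {μ : ℂ} (hμ : block M x x = μ • (1 : Matrix _ _ ℂ)) (hμΘ : Θ ≤ ‖μ‖) :
    (∀ s ∈ Set.Icc s₀ s₂, ∀ y, opNorm (block (siteDiag (fun _ => μ⁻¹) : BlockMat dim A A) x y) ≤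
      c * (N ^ (τ₂ + (ν + r) + s₀) * N ^ (s - s₀)) *
        bracket (siteSub x.1 y.1) ^ (-(s + (ν + r)))) ∧
    (∀ s ∈ Set.Icc s₀ s₂, ∀ y, opNorm (block (siteDiag (fun _ => μ⁻¹) * M - 1) x y) ≤
      c * (N ^ (τ₂ + (ν + r) + s₀) *
        (N ^ (s - s₀) + sNorm K₀ (s + (ν + r)) (M - blockDiag M))) *
        bracket (siteSub x.1 y.1) ^ (-(s + (ν + r)))) ∧
    ∀ y, opNorm (block (siteDiag (fun _ => μ⁻¹) * M - 1) x y) ≤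
      (Υ / Θ + c * N ^ (τ₂ + (ν + r) + s₀ - (1 - δ) * S)) *
        bracket (siteSub x.1 y.1) ^ (-(s₀ + (ν + r))) := by
  set b : ℝ := (ν : ℝ) + r with hb
  have hb0 : 0 ≤ b := by positivity
  set Q := M - blockDiag M with hQd
  have hT0 := hT s₀ ⟨le_rfl, by linarith⟩
  have hκ := hT0.one_le
  have hκK := hT0.le
  have hK1 : 1 ≤ K := hκ.trans hκK
  have h4 : (1 : ℝ) ≤ 4 ^ (s₂ + b) := Real.one_le_rpow (by norm_num) (by linarith)
  have hN0 : 0 < N := by linarith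
  have hNp : ∀ t : ℝ, 0 ≤ t → 1 ≤ N ^ t := fun t ht => Real.one_le_rpow hN ht
  have hc1 : 4 ^ (s₂ + b) ≤ c := by
    refine le_trans ?_ hc
    exact le_mul_of_one_le_right (by linarith) (by nlinarith)
  have hc2 : 4 ^ (s₂ + b) * (K * Υ) ≤ c := by
    refine le_trans (mul_le_mul_of_nonneg_left ?_ (by linarith)) hc
    nlinarith
  have hcK : 2 * (K * (1 + Υ)) ≤ c := le_trans (le_mul_of_one_le_left (by positivity) h4) hc
  have hc0 : 1 ≤ c := h4.trans hc1
  have hQ0 : sNorm K₀ s₀ Q ≤ Υ := (sNorm_mono_exponent (by linarith) (by linarith) Q).trans hQ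
  have hQn : ∀ s, 0 ≤ sNorm K₀ s Q := fun s => sNorm_nonneg _ _ _
  have hE : 1 ≤ N ^ (τ₂ + b + s₀) := hNp _ (by linarith)
  have hμ0 : μ ≠ 0 := by
    rintro rfl
    rw [norm_zero] at hμΘ
    linarith
  have hinv : ‖μ⁻¹‖ ≤ Θ⁻¹ := by
    rw [norm_inv]
    exact inv_anti₀ (by linarith) hμΘ
  have hinv1 : ‖μ⁻¹‖ ≤ 1 := hinv.trans (inv_le_one_of_one_le₀ hΘ)
  refine ⟨fun s hs y => ?_, fun s hs y => ?_, fun y => ?_⟩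
  · have hNs := hNp (s - s₀) (by linarith [hs.1])
    by_cases hxy : x = y
    · subst hxy
      rw [block_siteDiag_self, siteSub_self, bracket_zero, Real.one_rpow, mul_one]
      refine (opNorm_smul_one_le _).trans (hinv1.trans ?_)
      exact one_le_mul_of_one_le_of_one_le hc0 (one_le_mul_of_one_le_of_one_le hE hNs)
    · rw [block_siteDiag_ne _ hxy, opNorm_zero]
      exact mul_nonneg (by positivity) (bracket_rpow_nonneg _ _)
  · have hNs := hNp (s - s₀) (by linarith [hs.1])
    rw [block_smul_one_mul_sub_one hμ0 hμ, opNorm_smul]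
    calc _ ≤ 1 * (sNorm K₀ (s + b) Q * bracket (siteSub x.1 y.1) ^ (-(s + b))) :=
          mul_le_mul hinv1 (opNorm_block_le_sNorm hK₀ _ _ _ _) (opNorm_nonneg _) zero_le_one
      _ ≤ _ := by
          rw [one_mul]
          refine mul_le_mul_of_nonneg_right ?_ (bracket_rpow_nonneg _ _)
          calc sNorm K₀ (s + b) Q ≤ N ^ (s - s₀) + sNorm K₀ (s + b) Q := by linarith
            _ ≤ c * (N ^ (τ₂ + b + s₀) * (N ^ (s - s₀) + sNorm K₀ (s + b) Q)) := by
                have h1 : 0 ≤ N ^ (s - s₀) + sNorm K₀ (s + b) Q := by linarith [hQn (s + b)]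
                rw [← mul_assoc]
                exact le_mul_of_one_le_left h1 (one_le_mul_of_one_le_of_one_le hc0 hE)
  -- Here `Υ / Θ` alone suffices; the power of `N` is added only to share one bound with the
  -- `N`-regular sites.
  · rw [block_smul_one_mul_sub_one hμ0 hμ, opNorm_smul]
    have hQb : sNorm K₀ (s₀ + b) Q ≤ Υ := (sNorm_mono_exponent (by linarith) hS Q).trans hQ
    calc _ ≤ Θ⁻¹ * (Υ * bracket (siteSub x.1 y.1) ^ (-(s₀ + b))) := by
          refine mul_le_mul hinv ((opNorm_block_le_sNorm hK₀ (s₀ + b) _ _ _).trans ?_)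
            (opNorm_nonneg _) (by positivity)
          exact mul_le_mul_of_nonneg_right hQb (bracket_rpow_nonneg _ _)
      _ = Υ / Θ * bracket (siteSub x.1 y.1) ^ (-(s₀ + b)) := by ring
      _ ≤ _ := by
          refine mul_le_mul_of_nonneg_right ?_ (bracket_rpow_nonneg _ _)
          exact le_add_of_nonneg_right (by positivity)

/-- The block row of an approximate left inverse at an `N`-regular site, with its decay. -/
theorem exists_row_of_scaleRegular {K₀ s₀ S s₂ τ₂ δ Θ N κ K Υ c : ℝ} (hK₀ : 1 ≤ K₀)
    (hs₀ : 0 ≤ s₀) (hS : s₀ + (ν + r) ≤ S) (hSs₂ : S ≤ s₂) (hδ1 : δ ≤ 1)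
    (hτ₂ : 0 ≤ τ₂) (hΘ : 1 ≤ Θ) (hN : 1 ≤ N) (hΥ : 0 ≤ Υ)
    (hT : ∀ s ∈ Set.Icc s₀ (s₂ + (ν + r)),
      TamePair (sNorm (dim := dim) (C := A) (B := A) K₀ s₀) (sNorm K₀ s) κ K)
    (hc : 4 ^ (s₂ + (ν + r)) * (2 * (K * (1 + Υ))) ≤ c)
    {M : BlockMat dim A A} (hQ : sNorm K₀ S (M - blockDiag M) ≤ Υ)
    {x : {n // n ∈ A}} (hsr : IsScaleRegularSite K₀ s₀ S τ₂ δ N M x) :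
    ∃ f : BlockMat dim A A,
      (∀ s ∈ Set.Icc s₀ s₂, ∀ y, opNorm (block f x y) ≤
        c * (N ^ (τ₂ + (ν + r) + s₀) * N ^ (s - s₀)) *
          bracket (siteSub x.1 y.1) ^ (-(s + (ν + r)))) ∧
      (∀ s ∈ Set.Icc s₀ s₂, ∀ y, opNorm (block (f * M - 1) x y) ≤
        c * (N ^ (τ₂ + (ν + r) + s₀) *
          (N ^ (s - s₀) + sNorm K₀ (s + (ν + r)) (M - blockDiag M))) *
          bracket (siteSub x.1 y.1) ^ (-(s + (ν + r)))) ∧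
      ∀ y, opNorm (block (f * M - 1) x y) ≤
        (Υ / Θ + c * N ^ (τ₂ + (ν + r) + s₀ - (1 - δ) * S)) *
          bracket (siteSub x.1 y.1) ^ (-(s₀ + (ν + r))) := by
  set b : ℝ := (ν : ℝ) + r with hb
  have hb0 : 0 ≤ b := by positivity
  set Q := M - blockDiag M with hQd
  have hT0 := hT s₀ ⟨le_rfl, by linarith⟩
  have hκ := hT0.one_le
  have hκK := hT0.le
  have hK1 : 1 ≤ K := hκ.trans hκK
  have h4 : (1 : ℝ) ≤ 4 ^ (s₂ + b) := Real.one_le_rpow (by norm_num) (by linarith)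
  have hN0 : 0 < N := by linarith
  have hNp : ∀ t : ℝ, 0 ≤ t → 1 ≤ N ^ t := fun t ht => Real.one_le_rpow hN ht
  have hc1 : 4 ^ (s₂ + b) ≤ c := by
    refine le_trans ?_ hc
    exact le_mul_of_one_le_right (by linarith) (by nlinarith)
  have hc2 : 4 ^ (s₂ + b) * (K * Υ) ≤ c := by
    refine le_trans (mul_le_mul_of_nonneg_left ?_ (by linarith)) hc
    nlinarith
  have hcK : 2 * (K * (1 + Υ)) ≤ c := le_trans (le_mul_of_one_le_left (by positivity) h4) hc
  have hc0 : 1 ≤ c := h4.trans hc1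
  have hQ0 : sNorm K₀ s₀ Q ≤ Υ := (sNorm_mono_exponent (by linarith) (by linarith) Q).trans hQ
  have hQn : ∀ s, 0 ≤ sNorm K₀ s Q := fun s => sNorm_nonneg _ _ _
  have hE : 1 ≤ N ^ (τ₂ + b + s₀) := hNp _ (by linarith)
  obtain ⟨f, hf, hsupp, hfQ, hfar⟩ := exists_row_of_isScaleRegularSite (by linarith) hN0 hsr
  have hf0 : sNorm K₀ s₀ f ≤ N ^ (τ₂ + s₀) := by
    refine (hf s₀ ⟨le_rfl, by linarith⟩).trans (Real.rpow_le_rpow_of_exponent_le hN ?_)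
    nlinarith
  -- Goodness gives no information beyond regularity `S`; higher norms are obtained from the one at
  -- `s₀`, since `f` has range `4 * N`.
  have hfs : ∀ s ∈ Set.Icc s₀ s₂, sNorm K₀ (s + b) f ≤
      4 ^ (s₂ + b) * (N ^ (τ₂ + b + s₀) * N ^ (s - s₀)) := by
    intro s hs
    have h1 := sNorm_le_of_near (K₀ := K₀) (by linarith) (s := s₀) (s' := s + b)
      (by linarith [hs.1]) (by linarith : 0 ≤ 4 * N) (M := f)
      fun u v huv => bracket_le_of_siteDist_le (by linarith) (hsupp u v huv)
    calc _ ≤ (4 * N) ^ (s + b - s₀) * N ^ (τ₂ + s₀) :=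
          h1.trans (mul_le_mul_of_nonneg_left hf0 (by positivity))
      _ = 4 ^ (s + b - s₀) * (N ^ (τ₂ + b + s₀) * N ^ (s - s₀)) := by
          rw [Real.mul_rpow (by norm_num) hN0.le, mul_assoc, ← Real.rpow_add hN0,
            ← Real.rpow_add hN0]
          congr 2; ring
      _ ≤ _ := by
          refine mul_le_mul_of_nonneg_right ?_ (by positivity)
          exact Real.rpow_le_rpow_of_exponent_le (by norm_num) (by linarith [hs.2])
  refine ⟨f, fun s hs y => ?_, fun s hs y => ?_, fun y => ?_⟩
  · refine (opNorm_block_le_sNorm hK₀ (s + b) f x y).trans ?_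
    refine mul_le_mul_of_nonneg_right ((hfs s hs).trans ?_) (bracket_rpow_nonneg _ _)
    exact mul_le_mul_of_nonneg_right hc1 (by positivity)
  · refine (hfQ y).trans ((opNorm_block_le_sNorm hK₀ (s + b) _ x y).trans ?_)
    refine mul_le_mul_of_nonneg_right ?_ (bracket_rpow_nonneg _ _)
    have hTs := hT (s + b) ⟨by linarith [hs.1], by linarith [hs.2]⟩
    have hN1 : N ^ (τ₂ + s₀) ≤ N ^ (τ₂ + b + s₀) :=
      Real.rpow_le_rpow_of_exponent_le hN (by linarith)
    calc _ ≤ K * (N ^ (τ₂ + b + s₀) * sNorm K₀ (s + b) Q +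
          4 ^ (s₂ + b) * (N ^ (τ₂ + b + s₀) * N ^ (s - s₀)) * Υ) :=
          (hTs.mul_bound (hf0.trans hN1) (hfs s hs) hQ0 le_rfl).2
      _ = N ^ (τ₂ + b + s₀) * (K * sNorm K₀ (s + b) Q) +
          N ^ (τ₂ + b + s₀) * (4 ^ (s₂ + b) * (K * Υ) * N ^ (s - s₀)) := by ring
      _ ≤ N ^ (τ₂ + b + s₀) * (c * sNorm K₀ (s + b) Q) +
          N ^ (τ₂ + b + s₀) * (c * N ^ (s - s₀)) := by
          refine add_le_add ?_ ?_ <;> refine mul_le_mul_of_nonneg_left ?_ (by positivity)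
          · exact mul_le_mul_of_nonneg_right (by nlinarith) (hQn _)
          · exact mul_le_mul_of_nonneg_right hc2 (by positivity)
      _ = _ := by ring
  · by_cases h0 : block (f * M - 1) x y = 0
    · rw [h0, opNorm_zero]
      refine mul_nonneg (by positivity) (bracket_rpow_nonneg _ _)
    -- Distance at least `N` converts the excess regularity `S - s₀ - b` into a power of `N`: from
    -- `N ^ (τ₂ + δ * S)` one reaches the exponent `τ₂ + b + s₀ - (1 - δ) * S`.
    have hd : N ≤ bracket (siteSub x.1 y.1) := (hfar y h0).trans (siteDist_le_bracket _ _)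
    refine (hfQ y).trans ((opNorm_block_le_sNorm hK₀ S _ x y).trans ?_)
    have hTs := hT S ⟨by linarith, by linarith⟩
    have hfS : sNorm K₀ S f ≤ N ^ (τ₂ + δ * S) := hf S ⟨by linarith, le_rfl⟩
    have hf0S : sNorm K₀ s₀ f ≤ N ^ (τ₂ + δ * S) :=
      (sNorm_mono_exponent (by linarith) (by linarith) f).trans hfS
    have h1 : sNorm K₀ S (f * Q) ≤ c * N ^ (τ₂ + δ * S) := by
      calc _ ≤ K * (N ^ (τ₂ + δ * S) * Υ + N ^ (τ₂ + δ * S) * Υ) :=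
            (hTs.mul_bound hf0S hfS hQ0 hQ).2
        _ = 2 * (K * Υ) * N ^ (τ₂ + δ * S) := by ring
        _ ≤ _ := by
            refine mul_le_mul_of_nonneg_right ?_ (by positivity)
            linarith
    calc sNorm K₀ S (f * Q) * bracket (siteSub x.1 y.1) ^ (-S)
        = sNorm K₀ S (f * Q) * (bracket (siteSub x.1 y.1) ^ (s₀ + b - S) *
            bracket (siteSub x.1 y.1) ^ (-(s₀ + b))) := by
          rw [← Real.rpow_add (bracket_pos _)]; congr 2; ring
      _ ≤ c * N ^ (τ₂ + δ * S) * (N ^ (s₀ + b - S) *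
            bracket (siteSub x.1 y.1) ^ (-(s₀ + b))) := by
          have h2 : bracket (siteSub x.1 y.1) ^ (s₀ + b - S) ≤ N ^ (s₀ + b - S) :=
            Real.rpow_le_rpow_of_nonpos hN0 hd (by linarith)
          exact mul_le_mul h1 (mul_le_mul_of_nonneg_right h2 (bracket_rpow_nonneg _ _))
            (mul_nonneg (bracket_rpow_nonneg _ _) (bracket_rpow_nonneg _ _)) (by positivity)
      _ = c * N ^ (τ₂ + b + s₀ - (1 - δ) * S) * bracket (siteSub x.1 y.1) ^ (-(s₀ + b)) := by
          rw [mul_assoc c, ← mul_assoc (N ^ _), ← Real.rpow_add hN0, ← mul_assoc]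
          congr 3; ring
      _ ≤ _ := by
          refine mul_le_mul_of_nonneg_right ?_ (bracket_rpow_nonneg _ _)
          exact le_add_of_nonneg_left (by positivity)


end Multiscale

/-! ### The reduced matrix, and localization to the clusters -/

namespace Multiscale

section Identities

variable {R : Type*} [Ring R]

/-- Algebra of the elimination of the good sites: `x l` and `(1 - x γ) πB` express the unknowns
through the data and the bad unknowns, and `π' a (1 - x γ) πB` is the reduced matrix. -/
theorem elimination_identities {a a' l x γ πB π' d : R} (ha : a * a' = 1) (ha' : a' * a = 1)
    (hx : x * (1 + γ * (1 - πB)) = 1) (hx' : (1 + γ * (1 - πB)) * x = 1)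
    (hl : l * a = 1 - πB + γ) (hB : πB * πB = πB) (hBl : πB * l = 0) (hBγ : πB * γ = 0)
    (hπ : d * l = 1 - π') :
    πB * a' * (π' * a * ((1 - x * γ) * πB)) = πB ∧
    ∀ y, y * (π' * a * ((1 - x * γ) * πB)) = πB →
      a' = x * l + (1 - x * γ) * πB * (y * (π' - π' * a * (x * l))) := by
  have h1 := one_eq_of_elimination hx hl hB
  have h2 := left_mul_schur_eq_zero hx' hl hBl hBγ
  set u := (1 - x * γ) * πB with hu
  -- `1 - π' = d * l`, and `l` annihilates `1 - a * x * l`: projecting by `π'` loses nothing.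
  have h3 : π' * (1 - a * (x * l)) = 1 - a * (x * l) := by
    have : (1 - π') * (1 - a * (x * l)) = 0 := by rw [← hπ, mul_assoc, h2, mul_zero]
    rw [sub_mul, one_mul, sub_eq_zero] at this
    exact this.symm
  -- Because `u = 1 - x * l * a`. Consequently `y * a * u = πB` is equivalent to `y * (1 - a * x *
  -- l) = πB * a'`, from which the bad part of the inverse is read off.
  have h4 : a * u = (1 - a * (x * l)) * a := by
    have : u = 1 - x * l * a := by rw [eq_sub_iff_add_eq, add_comm]; exact h1.symm
    rw [this]; noncomm_ring
  have h5 : π' * a * u = a * u := by rw [mul_assoc, h4, ← mul_assoc, h3]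
  have h6 : πB * x = πB := by
    have : πB * ((1 + γ * (1 - πB)) * x) = πB * x := by
      rw [← mul_assoc, mul_add, ← mul_assoc, hBγ, zero_mul, add_zero, mul_one]
    rw [← this, hx', mul_one]
  have h7 : πB * u = πB := by
    rw [hu, ← mul_assoc, mul_sub, ← mul_assoc, h6, hBγ, mul_one, sub_zero, hB]
  rw [h5]
  refine ⟨by rw [mul_assoc, ← mul_assoc a', ha', one_mul, h7], fun y hy => ?_⟩
  have h8 : π' - π' * a * (x * l) = 1 - a * (x * l) := by rw [← h3]; noncomm_ring
  have h9 : y * (1 - a * (x * l)) = πB * a' := by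
    rw [← hy, h4, mul_assoc y, mul_assoc, ha, mul_one]
  have h10 : u * πB = u := by rw [hu, mul_assoc, hB]
  rw [h8, h9, ← mul_assoc, h10]
  calc a' = 1 * a' := (one_mul _).symm
    _ = (x * l * a + u) * a' := by rw [← h1]
    _ = _ := by rw [add_mul, mul_assoc (x * l), ha, mul_one]

end Identities

variable {ν r : ℕ} {dim : (Fin r → ℕ) → ℕ} {A B : Finset (Site ν r)}

/-- The site `n'` is `ρ`-close to the cluster of `m`. -/
def NearCluster (P : Finpartition B) (ρ : ℝ) (n' m : {n // n ∈ A}) : Prop :=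
  ∃ O ∈ P.parts, m.1 ∈ O ∧ ∃ o ∈ O, siteDist n'.1 o ≤ ρ

/-- A site within `ρ` of two distinct clusters would bring them within `2 * ρ < D` of each other. -/
theorem NearCluster.same {P : Finpartition B} {ρ D : ℝ} (hD : 2 * ρ < D)
    (hsep : ∀ O ∈ P.parts, ∀ O' ∈ P.parts, O ≠ O' → DistGE O O' D) {n' n m : {n // n ∈ A}}
    (h : NearCluster P ρ n' n) (h' : NearCluster P ρ n' m) :
    ∃ O ∈ P.parts, n.1 ∈ O ∧ m.1 ∈ O := by
  obtain ⟨O, hO, hn, o, ho, hd⟩ := h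
  obtain ⟨O', hO', hm, o', ho', hd'⟩ := h'
  by_cases hOO : O = O'
  · exact ⟨O, hO, hn, hOO ▸ hm⟩
  · have h1 := hsep O hO O' hO' hOO o ho o' ho'
    have h2 := siteDist_triangle o n'.1 o'
    rw [siteDist_comm o n'.1] at h2
    linarith

theorem NearCluster.of_same {P : Finpartition B} {ρ : ℝ} {n' n m : {n // n ∈ A}}
    (h : NearCluster P ρ n' m) {O : Finset (Site ν r)} (hO : O ∈ P.parts) (hn : n.1 ∈ O)
    (hm : m.1 ∈ O) : NearCluster P ρ n' n := by
  obtain ⟨O', hO', hm', o⟩ := h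
  obtain rfl := P.eq_of_mem_parts hO hO' hm hm'
  exact ⟨O, hO, hn, o⟩

theorem NearCluster.siteDist_le {P : Finpartition B} {ρ D : ℝ}
    (hdiam : ∀ O ∈ P.parts, DiamLE O D) {n' n : {n // n ∈ A}} (h : NearCluster P ρ n' n) :
    siteDist n.1 n'.1 ≤ D + ρ := by
  obtain ⟨O, hO, hn, o, ho, hd⟩ := h
  have h1 := hdiam O hO n.1 hn o ho
  have h2 := siteDist_triangle n.1 o n'.1
  rw [siteDist_comm o] at h2
  linarith

theorem lt_siteDist_of_not_nearCluster {P : Finpartition B} {ρ : ℝ} {n' m : {n // n ∈ A}}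
    (hm : m.1 ∈ B) (h : ¬ NearCluster P ρ n' m) : ρ < siteDist n'.1 m.1 := by
  by_contra hle
  exact h ⟨P.part m.1, P.part_mem.2 hm, P.mem_part hm, m.1, P.mem_part hm, not_lt.1 hle⟩

/-- A left inverse of a matrix supported near the clusters can be restricted to the clusters. -/
theorem blockMask_mul_blockMask_eq {P : Finpartition B} {ρ D : ℝ} (hD : 2 * ρ < D)
    (hsep : ∀ O ∈ P.parts, ∀ O' ∈ P.parts, O ≠ O' → DistGE O O' D) {U M : BlockMat dim A A}
    {c : {n // n ∈ A} → ℂ} (hc : ∀ x, x.1 ∉ B → c x = 0)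
    (h : U * blockMask (NearCluster P ρ) M = siteDiag c) :
    blockMask (fun n n' => NearCluster P ρ n' n) U * blockMask (NearCluster P ρ) M =
      siteDiag c := by
  refine eq_of_block_eq fun n m => ?_
  by_cases hnm : ∃ O ∈ P.parts, n.1 ∈ O ∧ m.1 ∈ O
  -- For `n` and `m` in one cluster the mask on `U` removes only terms already killed by the mask on
  -- `M`.
  · rw [← h, block_mul, block_mul]
    refine Finset.sum_congr rfl fun n' _ => ?_
    obtain ⟨O, hO, hn, hm⟩ := hnm
    by_cases hn' : NearCluster P ρ n' m
    · rw [block_blockMask_of_pos (Φ := fun n n' => NearCluster P ρ n' n) U (hn'.of_same hO hn hm)]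
    · rw [block_blockMask_of_neg M hn', Matrix.mul_zero, Matrix.mul_zero]
  -- Otherwise no `n'` is near both clusters, so the product vanishes, as does the corresponding
  -- block of the right-hand side.
  · rw [block_mul, Finset.sum_eq_zero]
    · by_cases hxy : n = m
      · subst hxy
        rw [block_siteDiag_self, hc, zero_smul]
        exact fun hB => hnm ⟨P.part n.1, P.part_mem.2 hB, P.mem_part hB, P.mem_part hB⟩
      · rw [block_siteDiag_ne _ hxy]
    · intro n' _
      by_cases h1 : NearCluster P ρ n' n
      · by_cases h2 : NearCluster P ρ n' m
        · exact absurd (h1.same hD hsep h2) hnm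
        · rw [block_blockMask_of_neg M h2, Matrix.mul_zero]
      · rw [block_blockMask_of_neg (Φ := fun n n' => NearCluster P ρ n' n) U h1, Matrix.zero_mul]

theorem opNorm_siteDiag_le {c : {n // n ∈ A} → ℂ} {X : ℝ} (hX : 0 ≤ X) (hc : ∀ x, ‖c x‖ ≤ X) :
    opNorm (siteDiag c : BlockMat dim A A) ≤ X := by
  open scoped Matrix.Norms.L2Operator in
  unfold opNorm siteDiag
  rw [Matrix.l2_opNorm_diagonal]
  exact (pi_norm_le_iff_of_nonneg hX).2 fun i => hc i.1

/-- Makes the Neumann lemmas available in operator norm, the only norm in which the reduced matrix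
is known to have a bounded left inverse at first. -/
theorem tamePair_opNorm {n : Type*} [Fintype n] [DecidableEq n] :
    TamePair (n := n) opNorm opNorm 1 1 where
  one_le := le_rfl
  le := le_rfl
  nonneg := opNorm_nonneg
  nonneg' := opNorm_nonneg
  eq_zero _ := opNorm_eq_zero.1
  neg := opNorm_neg
  neg' := opNorm_neg
  add_le := opNorm_add_le
  add_le' := opNorm_add_le
  mul_le M M' := by rw [one_mul]; exact opNorm_mul_le M M'
  mul_le' M M' := by
    have := opNorm_mul_le M M'
    have := mul_nonneg (opNorm_nonneg M) (opNorm_nonneg M')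
    linarith

/-- Neumann: `(1 + H)⁻¹ V` and its defining equation. -/
theorem TamePair.exists_inverse {n : Type*} [Fintype n] [DecidableEq n] {p q : Matrix n n ℂ → ℝ}
    {κ K : ℝ} (h : TamePair p q κ K) {H : Matrix n n ℂ} (hH : κ * p H ≤ 1 / 2) :
    ∃ J : Matrix n n ℂ, J * (1 + H) = 1 ∧ (1 + H) * J = 1 ∧
      ∀ V, J * V = V - H * (J * V) := by
  have hu := (Matrix.isUnit_iff_isUnit_det _).1 (h.isUnit_one_add hH)
  refine ⟨(1 + H)⁻¹, Matrix.nonsing_inv_mul _ hu, Matrix.mul_nonsing_inv _ hu, fun V => ?_⟩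
  have := Matrix.mul_nonsing_inv _ hu
  rw [eq_sub_iff_add_eq, ← mul_assoc, ← add_mul]
  nth_rw 1 [← one_mul (1 + H)⁻¹]
  rw [← add_mul, this, one_mul]

end Multiscale

/-! ### Elimination of the good sites -/

namespace Multiscale

variable {ν r : ℕ} {dim : (Fin r → ℕ) → ℕ} {A : Finset (Site ν r)}

open scoped Classical in
/-- The projection onto the bad sites. -/
noncomputable def badProj (K₀ s₀ S τ₂ δ Θ N : ℝ) (M : BlockMat dim A A) : BlockMat dim A A :=
  siteDiag fun x => if IsGoodSite K₀ s₀ S τ₂ δ Θ N M x then 0 else 1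

/-- Elimination of the good sites. -/
theorem exists_elimination (hν : 1 ≤ ν) {K₀ s₀ S s₂ τ₂ δ Θ N κ K Υ c e : ℝ} (hK₀ : 1 ≤ K₀)
    (hs₀ : 0 ≤ s₀) (hS : s₀ + (ν + r) ≤ S) (hSs₂ : S ≤ s₂) (hδ1 : δ ≤ 1)
    (hτ₂ : 0 ≤ τ₂) (he : e = τ₂ + (ν + r) + s₀) (hΘ : 1 ≤ Θ) (hN : 1 ≤ N) (hΥ : 0 ≤ Υ)
    (hT : ∀ s ∈ Set.Icc s₀ (s₂ + (ν + r)),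
      TamePair (sNorm (dim := dim) (C := A) (B := A) K₀ s₀) (sNorm K₀ s) κ K)
    (hc : 4 ^ (s₂ + (ν + r)) * (2 * (K * (1 + Υ))) ≤ c)
    (hsmall : κ * (decayConst ν r K₀ * (Υ / Θ + c * N ^ (e - (1 - δ) * S))) ≤ 1 / 2)
    {c' : ℝ} (hc' : 1 + Υ + decayConst ν r K₀ * (Θ + c) ≤ c')
    {M : BlockMat dim A A} (hM : IsUnit M) (hdiag : HasScalarDiag M)
    (hQ : sNorm K₀ S (M - blockDiag M) ≤ Υ) :
    ∃ W Ñ P Sm : BlockMat dim A A,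
      P * badProj K₀ s₀ S τ₂ δ Θ N M = P ∧
      badProj K₀ s₀ S τ₂ δ Θ N M * M⁻¹ * P = badProj K₀ s₀ S τ₂ δ Θ N M ∧
      (∀ Y, Y * P = badProj K₀ s₀ S τ₂ δ Θ N M → M⁻¹ = W + Ñ * (Y * Sm)) ∧
      sNorm K₀ s₀ Ñ ≤ 20 * K ^ 4 * c' ^ 5 ∧ sNorm K₀ s₀ Sm ≤ 20 * K ^ 4 * c' ^ 5 * N ^ e ∧
      ∀ s ∈ Set.Icc s₀ s₂, ∀ g, g = N ^ (s - s₀) + sNorm K₀ (s + (ν + r)) (M - blockDiag M) →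
        sNorm K₀ s Ñ ≤ 20 * K ^ 4 * c' ^ 5 * (N ^ e * g) ∧
        sNorm K₀ s P ≤ 20 * K ^ 4 * c' ^ 5 * (N ^ e * g) ∧
        sNorm K₀ s W ≤ 20 * K ^ 4 * c' ^ 5 * ((N ^ e) ^ 2 * g) ∧
        sNorm K₀ s Sm ≤ 20 * K ^ 4 * c' ^ 5 * ((N ^ e) ^ 2 * g) := by
  classical
  have hKn : 0 ≤ K₀ := by linarith
  set b : ℝ := (ν : ℝ) + r with hb
  have hb0 : 0 ≤ b := by positivity
  set Q := M - blockDiag M with hQd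
  set C₀ := decayConst ν r K₀ with hC₀
  have hC₀n : 0 ≤ C₀ := decayConst_nonneg K₀
  have hT0 := hT s₀ ⟨le_rfl, by linarith⟩
  have hK1 : 1 ≤ K := hT0.one_le.trans hT0.le
  have hc0 : 1 ≤ c := by
    refine le_trans ?_ hc
    refine one_le_mul_of_one_le_of_one_le (Real.one_le_rpow (by norm_num) (by linarith)) ?_
    nlinarith
  have hQn : ∀ s, 0 ≤ sNorm K₀ s Q := fun s => sNorm_nonneg _ _ _
  have hN0 : 0 < N := by linarith
  have hE : 1 ≤ N ^ e := Real.one_le_rpow hN (by rw [he]; linarith)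
  -- the diagonal
  have hμ : ∀ x, ∃ μ : ℂ, block M x x = μ • (1 : Matrix _ _ ℂ) ∧
      (IsRegularSite Θ M x ↔ Θ ≤ ‖μ‖) := by
    intro x
    -- An empty block is `μ • 1` for every `μ`, so the scalar is selected to exhibit regularity
    -- whenever the site is regular.
    by_cases hx : IsRegularSite Θ M x
    · obtain ⟨μ, h1, h2⟩ := hx
      exact ⟨μ, h1, iff_of_true ⟨μ, h1, h2⟩ h2⟩
    · obtain ⟨μ, h1⟩ := hdiag x
      exact ⟨μ, h1, fun h => absurd h hx, fun h => ⟨μ, h1, h⟩⟩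
  choose μ hμ hreg using hμ
  -- the rows of the approximate inverse
  have hrow : ∀ x, ∃ f : BlockMat dim A A,
      (¬ IsGoodSite K₀ s₀ S τ₂ δ Θ N M x → f = 0) ∧
      (Θ ≤ ‖μ x‖ → f = siteDiag fun _ => (μ x)⁻¹) ∧
      (∀ s ∈ Set.Icc s₀ s₂, ∀ y, opNorm (block f x y) ≤
        c * (N ^ e * N ^ (s - s₀)) * bracket (siteSub x.1 y.1) ^ (-(s + b))) ∧
      (IsGoodSite K₀ s₀ S τ₂ δ Θ N M x →
        (∀ s ∈ Set.Icc s₀ s₂, ∀ y, opNorm (block (f * M - 1) x y) ≤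
          c * (N ^ e * (N ^ (s - s₀) + sNorm K₀ (s + b) Q)) *
            bracket (siteSub x.1 y.1) ^ (-(s + b))) ∧
        ∀ y, opNorm (block (f * M - 1) x y) ≤ (Υ / Θ + c * N ^ (e - (1 - δ) * S)) *
          bracket (siteSub x.1 y.1) ^ (-(s₀ + b))) := by
    intro x
    rw [he]
    -- Regularity takes precedence over `N`-regularity: the identity `d * L = 1 - π'` needs the row
    -- `μ⁻¹` at every regular site.
    by_cases hx : Θ ≤ ‖μ x‖
    · obtain ⟨h1, h2, h3⟩ := row_of_regular (δ := δ) hK₀ hs₀ hS hSs₂ hτ₂ hΘ hN hΥ hT hc hQ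
        (hμ x) hx
      exact ⟨_, fun h => absurd (Or.inl ((hreg x).2 hx)) h, fun _ => rfl, h1, fun _ => ⟨h2, h3⟩⟩
    · by_cases hg : IsGoodSite K₀ s₀ S τ₂ δ Θ N M x
      · obtain ⟨f, h1, h2, h3⟩ := exists_row_of_scaleRegular hK₀ hs₀ hS hSs₂ hδ1 hτ₂ hΘ hN hΥ hT
          hc hQ (hg.resolve_left fun h => hx ((hreg x).1 h))
        exact ⟨f, fun h => absurd hg h, fun h => absurd h hx, h1, fun _ => ⟨h2, h3⟩⟩
      · refine ⟨0, fun _ => rfl, fun h => absurd h hx, fun s hs y => ?_, fun h => absurd h hg⟩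
        rw [block_zero, opNorm_zero]
        exact mul_nonneg (by positivity) (bracket_rpow_nonneg _ _)
  choose f hfbad hfreg hfL hfΓ using hrow
  set πB := badProj K₀ s₀ S τ₂ δ Θ N M with hπB
  have hone : (1 : BlockMat dim A A) - πB =
      siteDiag fun x => if IsGoodSite K₀ s₀ S τ₂ δ Θ N M x then 1 else 0 := by
    rw [hπB, badProj, ← siteDiag_one, siteDiag_sub]
    congr 1; ext x; split_ifs <;> simp
  set L := rowAssemble f with hL
  set Γ := L * M - (1 - πB) with hΓ
  have hblockΓ : ∀ x y, IsGoodSite K₀ s₀ S τ₂ δ Θ N M x →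
      block Γ x y = block (f x * M - 1) x y := by
    intro x y hx
    rw [hΓ, hone, block_sub, block_sub, hL, rowAssemble_mul, block_rowAssemble]
    congr 1
    by_cases hxy : x = y
    · subst hxy
      rw [block_siteDiag_self, block_one_self, if_pos hx, one_smul]
    · rw [block_siteDiag_ne _ hxy, block_one_ne hxy]
  have hblockΓ0 : ∀ x y, ¬ IsGoodSite K₀ s₀ S τ₂ δ Θ N M x → block Γ x y = 0 := by
    intro x y hx
    rw [hΓ, hone, block_sub, hL, rowAssemble_mul, block_rowAssemble, hfbad x hx, zero_mul,
      block_zero, zero_sub, neg_eq_zero]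
    by_cases hxy : x = y
    · subst hxy
      rw [block_siteDiag_self, if_neg hx, zero_smul]
    · rw [block_siteDiag_ne _ hxy]
  have hΓs : ∀ s ∈ Set.Icc s₀ s₂, sNorm K₀ s Γ ≤
      C₀ * (c * (N ^ e * (N ^ (s - s₀) + sNorm K₀ (s + b) Q))) := by
    intro s hs
    have h0 : 0 ≤ c * (N ^ e * (N ^ (s - s₀) + sNorm K₀ (s + b) Q)) := by
      have := hQn (s + b)
      positivity
    refine sNorm_le_decayConst_mul hν hKn h0 fun x y => ?_
    by_cases hx : IsGoodSite K₀ s₀ S τ₂ δ Θ N M x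
    · rw [hblockΓ x y hx]
      exact (hfΓ x hx).1 s hs y
    · rw [hblockΓ0 x y hx, opNorm_zero]
      exact mul_nonneg h0 (bracket_rpow_nonneg _ _)
  have hΓ0 : sNorm K₀ s₀ Γ ≤ C₀ * (Υ / Θ + c * N ^ (e - (1 - δ) * S)) := by
    have h0 : 0 ≤ Υ / Θ + c * N ^ (e - (1 - δ) * S) := by positivity
    refine sNorm_le_decayConst_mul hν hKn h0 fun x y => ?_
    by_cases hx : IsGoodSite K₀ s₀ S τ₂ δ Θ N M x
    · rw [hblockΓ x y hx]
      exact (hfΓ x hx).2 y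
    · rw [hblockΓ0 x y hx, opNorm_zero]
      exact mul_nonneg h0 (bracket_rpow_nonneg _ _)
  have hLs : ∀ s ∈ Set.Icc s₀ s₂, sNorm K₀ s L ≤ C₀ * (c * (N ^ e * N ^ (s - s₀))) := fun s hs =>
    sNorm_le_decayConst_mul hν hKn (by positivity) fun x y => hfL x s hs y
  set Γ' := Γ * (1 - πB) with hΓ'
  have hΓ'le : ∀ s, sNorm K₀ s Γ' ≤ sNorm K₀ s Γ := fun s => by
    rw [hΓ', hone]
    refine sNorm_mul_siteDiag_le hKn s (fun x => ?_) Γ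
    split_ifs <;> simp
  have hκΓ : κ * sNorm K₀ s₀ Γ ≤ 1 / 2 :=
    (mul_le_mul_of_nonneg_left hΓ0 (by linarith [hT0.one_le])).trans hsmall
  have hκΓ' : κ * sNorm K₀ s₀ Γ' ≤ 1 / 2 :=
    (mul_le_mul_of_nonneg_left (hΓ'le s₀) (by linarith [hT0.one_le])).trans hκΓ
  obtain ⟨X, hX1, hX2, hX3⟩ := hT0.exists_inverse hκΓ'
  have hX : X = 1 - Γ' * X := by simpa using hX3 1
  -- the regular sites
  set π' : BlockMat dim A A := siteDiag fun x => if Θ ≤ ‖μ x‖ then 0 else 1 with hπ'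
  have hdL : (siteDiag fun x => if Θ ≤ ‖μ x‖ then μ x else 0) * L = 1 - π' := by
    rw [hπ', ← siteDiag_one, siteDiag_sub]
    refine eq_of_block_eq fun x y => ?_
    rw [block_siteDiag_mul, hL, block_rowAssemble]
    by_cases hx : Θ ≤ ‖μ x‖
    · have hμ0 : μ x ≠ 0 := by
        intro h
        rw [h, norm_zero] at hx
        linarith
      rw [hfreg x hx]
      by_cases hxy : x = y
      · subst hxy
        rw [block_siteDiag_self, block_siteDiag_self, if_pos hx, if_pos hx, smul_smul,
          mul_inv_cancel₀ hμ0, sub_zero]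
      · rw [block_siteDiag_ne _ hxy, block_siteDiag_ne _ hxy, smul_zero]
    · rw [if_neg hx, zero_smul]
      by_cases hxy : x = y
      · subst hxy
        rw [block_siteDiag_self, if_neg hx, sub_self, zero_smul]
      · rw [block_siteDiag_ne _ hxy]
  -- The diagonal of `M` is not bounded, but `π'` removes its entries of modulus at least `Θ`; the
  -- norm of `A'` is then controlled by `Θ` and `Q`.
  set A' := π' * M with hA'
  have hA'eq : A' = (siteDiag fun x => if Θ ≤ ‖μ x‖ then 0 else μ x) + π' * Q := by
    refine eq_of_block_eq fun x y => ?_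
    rw [block_add, hA', hπ', block_siteDiag_mul, block_siteDiag_mul]
    by_cases hxy : x = y
    · subst hxy
      rw [block_siteDiag_self, hQd, block_offDiag_self, smul_zero, add_zero, hμ, smul_smul]
      congr 1
      split_ifs <;> simp
    · rw [block_siteDiag_ne _ hxy, hQd, block_offDiag_ne M hxy, zero_add]
  have hA's : ∀ s, sNorm K₀ s A' ≤ C₀ * Θ + sNorm K₀ s Q := by
    intro s
    rw [hA'eq]
    refine (sNorm_add_le (by linarith) s _ _).trans (add_le_add ?_ ?_)
    · refine sNorm_siteDiag_le hν hKn s (by linarith) fun x => ?_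
      split_ifs with h
      · rw [norm_zero]; linarith
      · exact (not_le.1 h).le
    · refine sNorm_siteDiag_mul_le hKn s (fun x => ?_) Q
      split_ifs <;> simp
  have hπ's : ∀ s, sNorm K₀ s π' ≤ C₀ * 1 := fun s =>
    sNorm_siteDiag_le hν hKn s zero_le_one fun x => by split_ifs <;> simp
  have hπBs : ∀ s, sNorm K₀ s πB ≤ C₀ * 1 := fun s =>
    sNorm_siteDiag_le hν hKn s zero_le_one fun x => by split_ifs <;> simp
  have h1s : ∀ s, sNorm K₀ s (1 : BlockMat dim A A) ≤ C₀ * 1 := fun s => by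
    rw [← siteDiag_one]
    exact sNorm_siteDiag_le hν hKn s zero_le_one fun x => by simp
  have hBB : πB * πB = πB := by
    rw [hπB, badProj, siteDiag_mul_siteDiag]
    congr 1; ext x; split_ifs <;> simp
  have hBL : πB * L = 0 := by
    refine eq_of_block_eq fun x y => ?_
    rw [hπB, badProj, block_siteDiag_mul, hL, block_rowAssemble, block_zero]
    split_ifs with hx
    · rw [zero_smul]
    · rw [hfbad x hx, block_zero, smul_zero]
  have hBΓ : πB * Γ = 0 := by
    refine eq_of_block_eq fun x y => ?_
    rw [hπB, badProj, block_siteDiag_mul, block_zero]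
    split_ifs with hx
    · rw [zero_smul]
    · rw [hblockΓ0 x y hx, smul_zero]
  have hMdet := (Matrix.isUnit_iff_isUnit_det _).1 hM
  obtain ⟨i1, i2⟩ := elimination_identities (Matrix.mul_nonsing_inv _ hMdet)
    (Matrix.nonsing_inv_mul _ hMdet) hX1 hX2 (show L * M = 1 - πB + Γ by rw [hΓ]; abel) hBB hBL hBΓ
    hdL
  -- numerical bounds
  have hΘc : C₀ * (Θ + c) = C₀ * Θ + C₀ * c := mul_add _ _ _
  have hC1 : C₀ * 1 ≤ C₀ * Θ := mul_le_mul_of_nonneg_left hΘ hC₀n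
  have hC2 : 0 ≤ C₀ * c := by positivity
  have hC3 : 0 ≤ C₀ * Θ := by positivity
  have hc'1 : 1 ≤ c' := by linarith
  have hcc : C₀ * c ≤ c' := by linarith
  have hall : ∀ s ∈ Set.Icc s₀ s₂, ∀ g, g = N ^ (s - s₀) + sNorm K₀ (s + b) Q →
      (sNorm K₀ s₀ ((1 - X * Γ) * πB) ≤ 20 * K ^ 4 * c' ^ 5 ∧
        sNorm K₀ s ((1 - X * Γ) * πB) ≤ 20 * K ^ 4 * c' ^ 5 * (N ^ e * g)) ∧
      sNorm K₀ s (A' * ((1 - X * Γ) * πB)) ≤ 20 * K ^ 4 * c' ^ 5 * (N ^ e * g) ∧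
      (sNorm K₀ s₀ (X * L) ≤ 20 * K ^ 4 * c' ^ 5 * N ^ e ∧
        sNorm K₀ s (X * L) ≤ 20 * K ^ 4 * c' ^ 5 * ((N ^ e) ^ 2 * g)) ∧
      (sNorm K₀ s₀ (π' - A' * (X * L)) ≤ 20 * K ^ 4 * c' ^ 5 * N ^ e ∧
        sNorm K₀ s (π' - A' * (X * L)) ≤ 20 * K ^ 4 * c' ^ 5 * ((N ^ e) ^ 2 * g)) := by
    intro s hs g hg
    have hNs : 1 ≤ N ^ (s - s₀) := Real.one_le_rpow hN (by linarith [hs.1])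
    have hg1 : 1 ≤ g := by linarith [hQn (s + b)]
    have hgN : N ^ (s - s₀) ≤ g := by linarith [hQn (s + b)]
    have hEg : 0 ≤ N ^ e * g := by positivity
    have hqs : sNorm K₀ s Q ≤ g := by
      have := sNorm_mono_exponent hKn (show s ≤ s + b by linarith) Q
      linarith
    have hΓg : sNorm K₀ s Γ ≤ c' * (N ^ e * g) := by
      refine (hΓs s hs).trans ?_
      rw [← hg, ← mul_assoc]
      exact mul_le_mul_of_nonneg_right hcc hEg
    refine (hT s ⟨hs.1, by linarith [hs.2]⟩).elimination_bounds (X := X) (Γ := Γ) (Γ' := Γ')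
      (L := L) (A' := A') (πB := πB) (π' := π') hc'1 hE hg1 hX hκΓ' ((hΓ'le s).trans hΓg)
      ?_ hΓg ?_ ?_ ?_ ?_ ?_ ?_ ?_ ?_ ?_ ?_
    · nlinarith [hT0.one_le, hT0.nonneg Γ]
    · refine (hLs s₀ ⟨le_rfl, by linarith⟩).trans ?_
      rw [sub_self, Real.rpow_zero, mul_one, ← mul_assoc]
      exact mul_le_mul_of_nonneg_right hcc (by positivity)
    · refine (hLs s hs).trans ?_
      rw [← mul_assoc]
      exact mul_le_mul hcc (mul_le_mul_of_nonneg_left hgN (by positivity)) (by positivity)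
        (by linarith)
    · linarith [h1s s₀]
    · linarith [h1s s]
    · linarith [hπBs s₀]
    · linarith [hπBs s]
    · linarith [hπ's s₀]
    · linarith [hπ's s]
    · have := (sNorm_mono_exponent hKn (show s₀ ≤ S by linarith) Q).trans hQ
      linarith [hA's s₀]
    · have h1 : C₀ * Θ ≤ C₀ * Θ * g := le_mul_of_one_le_right hC3 hg1
      have h2 : (C₀ * Θ + 1) * g ≤ c' * g := mul_le_mul_of_nonneg_right (by linarith) (by linarith)
      linarith [hA's s]
  refine ⟨X * L, (1 - X * Γ) * πB, A' * ((1 - X * Γ) * πB), π' - A' * (X * L), ?_, i1, i2, ?_, ?_,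
    fun s hs g hg => ?_⟩
  · rw [mul_assoc A', mul_assoc (1 - X * Γ), hBB]
  · exact (hall s₀ ⟨le_rfl, by linarith⟩ _ rfl).1.1
  · exact (hall s₀ ⟨le_rfl, by linarith⟩ _ rfl).2.2.2.1
  · obtain ⟨⟨-, h2⟩, h3, ⟨-, h4⟩, -, h5⟩ := hall s hs g hg
    exact ⟨h2, h3, h4, h5⟩

end Multiscale

/-! ### Inversion on the clusters -/

namespace Multiscale

variable {ν r : ℕ} {dim : (Fin r → ℕ) → ℕ} {A : Finset (Site ν r)}

/-- A left inverse with decay of a matrix that is left invertible up to a small off-cluster part. -/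
theorem exists_cluster_left_inverse (hν : 1 ≤ ν) {K₀ s₀ C₁ N T : ℝ}
    (hs₀ : (ν : ℝ) + r < 2 * s₀)
    (hK₀ : 4 * ∑' k : LatticePt ν r, bracket k ^ (-(2 * s₀)) < K₀) (hC₁ : 2 ≤ C₁) (hN : 1 ≤ N)
    {B : Finset (Site ν r)} (hB : HasSeparatedPartition B (N ^ C₁) (N ^ (2 : ℝ)))
    {c : {n // n ∈ A} → ℂ} (hc : ∀ x, x.1 ∉ B → c x = 0) (hc1 : ∀ x, ‖c x‖ ≤ 1)
    {P G : BlockMat dim A A} (hP : P * siteDiag c = P) (hG : siteDiag c * G * P = siteDiag c)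
    (hGT : opNorm G ≤ T)
    {t ρ : ℝ} (ht : s₀ ≤ t) (hρ : (N ^ (2 : ℝ) / 4) ^ (s₀ - t) * sNorm K₀ t P ≤ ρ)
    (hTρ : T * ρ ≤ 1 / 2) :
    ∃ V R : BlockMat dim A A, V * (P - R) = siteDiag c ∧ R * siteDiag c = R ∧
      sNorm K₀ s₀ R ≤ ρ ∧ (∀ s, sNorm K₀ s R ≤ sNorm K₀ s P) ∧
      ∀ s, 0 ≤ s → sNorm K₀ s V ≤
        decayConst ν r K₀ * (2 * T * (2 * N ^ C₁) ^ (s + ((ν : ℝ) + r))) := by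
  obtain ⟨Pt, hdiam, hsep⟩ := hB
  have hK4 := four_lt_of_tsum_lt hs₀ hK₀
  have hKn : 0 ≤ K₀ := by linarith
  set πB : BlockMat dim A A := siteDiag c with hπB
  have hN0 : 0 < N := by linarith
  have hN2 : 0 < N ^ (2 : ℝ) := by positivity
  have hT0 : 0 ≤ T := (opNorm_nonneg G).trans hGT
  -- Radius `N² / 4` keeps the neighbourhoods of distinct clusters disjoint (`2 * d < N²`) and still
  -- leaves a distance of order `N²` for the decay of `R`.
  set d := N ^ (2 : ℝ) / 4 with hd
  have hd0 : 0 < d := by positivity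
  set Z := blockMask (NearCluster Pt d) P with hZ
  set R := P - Z with hR
  have hRpos : ∀ x y, NearCluster Pt d x y → block R x y = 0 := fun x y h => by
    rw [hR, block_sub, hZ, block_blockMask_of_pos P h, sub_self]
  have hRneg : ∀ x y, ¬ NearCluster Pt d x y → block R x y = block P x y := fun x y h => by
    rw [hR, block_sub, hZ, block_blockMask_of_neg P h, sub_zero]
  have hPy : ∀ x y, c y • block P x y = block P x y := fun x y => by
    rw [← block_mul_siteDiag, hP]
  have hRP : ∀ s, sNorm K₀ s R ≤ sNorm K₀ s P := fun s => sNorm_mono_of_block hKn s fun x y => by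
    by_cases h : NearCluster Pt d x y
    · rw [hRpos x y h, opNorm_zero]; exact opNorm_nonneg _
    · rw [hRneg x y h]
  have hRc : R * πB = R := by
    refine eq_of_block_eq fun x y => ?_
    rw [block_mul_siteDiag]
    by_cases h : NearCluster Pt d x y
    · rw [hRpos x y h, smul_zero]
    · rw [hRneg x y h, hPy]
  have hRs₀ : sNorm K₀ s₀ R ≤ ρ := by
    refine (sNorm_le_of_far hKn ht hd0 fun x y hne => ?_).trans
      ((mul_le_mul_of_nonneg_left (hRP t) (by positivity)).trans hρ)
    by_cases h : NearCluster Pt d x y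
    · exact absurd (hRpos x y h) hne
    · have hy : y.1 ∈ B := by
        by_contra hy
        exact hne (by rw [hRneg x y h, ← hPy, hc y hy, zero_smul])
      exact (lt_siteDist_of_not_nearCluster hy h).le.trans (siteDist_le_bracket _ _)
  have hπBn : opNorm πB ≤ 1 := opNorm_siteDiag_le zero_le_one hc1
  have hπG : opNorm (πB * G) ≤ T := by
    refine (opNorm_mul_le _ _).trans ?_
    calc _ ≤ 1 * T := mul_le_mul hπBn hGT (opNorm_nonneg _) zero_le_one
      _ = T := one_mul T
  -- Since `πB * G * Z = (1 - πB * G * R) * πB`, inverting this factor turns the left inverse of `P`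
  -- into one of its cluster part `Z`.
  have hH : 1 * opNorm (-(πB * G * R)) ≤ 1 / 2 := by
    rw [one_mul, opNorm_neg]
    refine (opNorm_mul_le _ _).trans (le_trans ?_ hTρ)
    exact mul_le_mul hπG ((opNorm_le_sNorm hs₀ hK₀ R).trans hRs₀) (opNorm_nonneg _) hT0
  obtain ⟨J, hJ1, -, hJ3⟩ := tamePair_opNorm.exists_inverse hH
  set U := J * (πB * G) with hU
  have hUn : opNorm U ≤ 2 * T :=
    (tamePair_opNorm.le_two_mul hH (hJ3 (πB * G))).trans (by linarith)
  have hUZ : U * Z = πB := by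
    have hZ' : Z = P - R := by rw [hR]; abel
    calc U * Z = J * (πB * G * P - πB * G * R) := by rw [hU, hZ', mul_assoc, mul_sub]
      _ = J * ((1 + -(πB * G * R)) * πB) := by
          rw [hG]
          congr 1
          rw [add_mul, one_mul, neg_mul, mul_assoc _ R, hRc, sub_eq_add_neg]
      _ = πB := by rw [← mul_assoc, hJ1, one_mul]
  have hNC : N ^ (2 : ℝ) ≤ N ^ C₁ := Real.rpow_le_rpow_of_exponent_le hN hC₁
  have h1N : 1 ≤ N ^ C₁ := Real.one_le_rpow hN (by linarith)
  refine ⟨blockMask (fun n n' => NearCluster Pt d n' n) U, R, ?_, hRc, hRs₀, hRP, fun s hs => ?_⟩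
  · rw [show P - R = Z by rw [hR]; abel]
    exact blockMask_mul_blockMask_eq (by rw [hd]; linarith) hsep hc hUZ
  · refine sNorm_le_decayConst_mul hν hKn (by positivity) fun x y => ?_
    by_cases h : NearCluster Pt d y x
    -- The range is at most the diameter of a cluster plus `N² / 4`, and `C₁ ≥ 2` absorbs the second
    -- term. Within it a bounded block decays at any rate, up to a power of `2 * N ^ C₁`.
    · have hbr : bracket (siteSub x.1 y.1) ≤ 2 * N ^ C₁ := by
        refine bracket_le_of_siteDist_le (by linarith) ((h.siteDist_le hdiam).trans ?_)
        rw [hd]; linarith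
      have hpos : 0 ≤ s + ((ν : ℝ) + r) := by positivity
      have h1 : 1 ≤ (2 * N ^ C₁) ^ (s + ((ν : ℝ) + r)) *
          bracket (siteSub x.1 y.1) ^ (-(s + ((ν : ℝ) + r))) := by
        rw [Real.rpow_neg (bracket_pos _).le, ← div_eq_mul_inv,
          one_le_div (Real.rpow_pos_of_pos (bracket_pos _) _)]
        exact Real.rpow_le_rpow (bracket_pos _).le hbr hpos
      refine (opNorm_block_blockMask_le _ U x y).trans ((opNorm_block_le U x y).trans ?_)
      rw [mul_assoc]
      exact hUn.trans (le_mul_of_one_le_right (by positivity) h1)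
    · rw [block_blockMask_of_neg (Φ := fun n n' => NearCluster Pt d n' n) U h, opNorm_zero]
      exact mul_nonneg (by positivity) (bracket_rpow_nonneg _ _)

end Multiscale

/-! ### Assembling the inverse -/

namespace Multiscale

variable {ν r : ℕ} {dim : (Fin r → ℕ) → ℕ} {A : Finset (Site ν r)}

/-- The bound on the inverse at the larger scale, in terms of explicit constants. -/
theorem sNorm_inv_le (hν : 1 ≤ ν) {K₀ s₀ S s₂ τ₂ δ Θ N κ K Υ c e C₁ T : ℝ}
    (hs₀ : (ν : ℝ) + r < 2 * s₀)
    (hK₀ : 4 * ∑' k : LatticePt ν r, bracket k ^ (-(2 * s₀)) < K₀)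
    (hS : s₀ + (ν + r) ≤ S) (hSs₂ : S ≤ s₂) (hδ1 : δ ≤ 1)
    (hτ₂ : 0 ≤ τ₂) (he : e = τ₂ + (ν + r) + s₀) (hΘ : 1 ≤ Θ) (hN : 1 ≤ N) (hΥ : 0 ≤ Υ)
    (hC₁ : 2 ≤ C₁)
    (hT : ∀ s ∈ Set.Icc s₀ (s₂ + (ν + r)),
      TamePair (sNorm (dim := dim) (C := A) (B := A) K₀ s₀) (sNorm K₀ s) κ K)
    (hc : 4 ^ (s₂ + (ν + r)) * (2 * (K * (1 + Υ))) ≤ c)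
    (hsmall : κ * (decayConst ν r K₀ * (Υ / Θ + c * N ^ (e - (1 - δ) * S))) ≤ 1 / 2)
    {c₁ c₂ : ℝ} (hc₁ : c₁ = 20 * K ^ 4 * (1 + Υ + decayConst ν r K₀ * (Θ + c)) ^ 5)
    (hc₂ : c₂ = decayConst ν r K₀ * (2 * 2 ^ (s₂ + (ν + r)))) {M : BlockMat dim A A}
    (hM : IsUnit M) (hdiag : HasScalarDiag M) (hQ : sNorm K₀ S (M - blockDiag M) ≤ Υ)
    (hT1 : 1 ≤ T) (hMT : opNorm M⁻¹ ≤ T)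
    (hsmall' : (1 + κ * (κ * c₂)) * (T * N ^ (C₁ * (s₀ + (ν + r))) *
      (c₁ * (1 + Υ) * 4 ^ s₂ * N ^ (e - (S - (ν + r) - s₀)))) ≤ 1 / 2)
    (hB : HasSeparatedPartition (badSites K₀ s₀ S τ₂ δ Θ N M) (N ^ C₁) (N ^ (2 : ℝ)))
    {s : ℝ} (hs : s ∈ Set.Icc s₀ s₂) :
    sNorm K₀ s M⁻¹ ≤ 20 * K ^ 4 * (c₁ + c₂) ^ 5 *
      ((T * N ^ (C₁ * (s₀ + (ν + r)))) ^ 2 * (N ^ e) ^ 2 *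
        (N ^ (C₁ * (s - s₀)) + sNorm K₀ (s + (ν + r)) (M - blockDiag M))) := by
  classical
  have hK4 := four_lt_of_tsum_lt hs₀ hK₀
  set b : ℝ := (ν : ℝ) + r with hb
  have hb0 : 0 ≤ b := by positivity
  have hs₀n : 0 ≤ s₀ := by linarith
  set Q := M - blockDiag M with hQd
  set C₀ := decayConst ν r K₀ with hC₀
  have hC₀n : 0 ≤ C₀ := decayConst_nonneg K₀
  have hT0 := hT s₀ ⟨le_rfl, by linarith⟩
  have hκ1 := hT0.one_le
  have hK1 : 1 ≤ K := hκ1.trans hT0.le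
  have hN0 : 0 < N := by linarith
  have hQn : ∀ s, 0 ≤ sNorm K₀ s Q := fun s => sNorm_nonneg _ _ _
  have hc0 : 0 ≤ c := le_trans (by positivity) hc
  have hc₁1 : 1 ≤ c₁ := by
    have h1 : 1 ≤ 1 + Υ + C₀ * (Θ + c) := by
      have : 0 ≤ C₀ * (Θ + c) := by positivity
      linarith
    have h2 : 1 ≤ K ^ 4 := one_le_pow₀ hK1
    have h3 : 1 ≤ (1 + Υ + C₀ * (Θ + c)) ^ 5 := one_le_pow₀ h1
    rw [hc₁]
    exact one_le_mul_of_one_le_of_one_le (by linarith) h3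
  have hc₂0 : 0 ≤ c₂ := by rw [hc₂]; positivity
  have hE : 1 ≤ N ^ e := Real.one_le_rpow hN (by rw [he]; linarith)
  obtain ⟨W, Ñ, P, Sm, hP, hPl, hinv, hNs, hSs, hbd⟩ := exists_elimination hν (by linarith) hs₀n hS
    hSs₂ hδ1 hτ₂ he hΘ hN hΥ hT hc hsmall le_rfl hM hdiag hQ
  rw [← hc₁] at hNs hSs hbd
  set ρ := c₁ * (1 + Υ) * 4 ^ s₂ * N ^ (e - (S - b - s₀)) with hρ
  have hρ0 : 0 ≤ ρ := by positivity
  set a := T * N ^ (C₁ * (s₀ + b)) with ha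
  have hNa : 1 ≤ N ^ (C₁ * (s₀ + b)) := Real.one_le_rpow hN (by positivity)
  have ha1 : 1 ≤ a := one_le_mul_of_one_le_of_one_le hT1 hNa
  have hTa : T ≤ a := le_mul_of_one_le_right (by linarith) hNa
  have haρ0 : 0 ≤ a * ρ := by positivity
  have hκc : 0 ≤ κ * (κ * c₂) := by positivity
  have hm : κ * (κ * c₂) * (a * ρ) ≤ 1 / 2 :=
    (mul_le_mul_of_nonneg_right (by linarith) haρ0).trans hsmall'
  have haρ : a * ρ ≤ 1 / 2 := (le_mul_of_one_le_left haρ0 (by linarith)).trans hsmall'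
  have hTρ : T * ρ ≤ 1 / 2 := (mul_le_mul_of_nonneg_right hTa hρ0).trans haρ
  have hρ1 : ρ ≤ 1 := (le_mul_of_one_le_left hρ0 ha1).trans (haρ.trans (by norm_num))
  -- the off-cluster part at the threshold regularity
  have hfar : (N ^ (2 : ℝ) / 4) ^ (s₀ - (S - b)) * sNorm K₀ (S - b) P ≤ ρ := by
    -- The bound on `P` at regularity `s` involves `Q` at `s + b`, so `S - b` is the highest
    -- regularity where `Υ` can be used. The gain `N ^ (-2 * (S - b - s₀))` from distances beyond
    -- `N² / 4` outweighs the growth `N ^ (S - b - s₀)`.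
    obtain ⟨-, h1, -⟩ := hbd (S - b) ⟨by linarith, by linarith⟩ _ rfl
    rw [sub_add_cancel] at h1
    have hNt : 1 ≤ N ^ (S - b - s₀) := Real.one_le_rpow hN (by linarith)
    have h2 : N ^ (S - b - s₀) + sNorm K₀ S Q ≤ (1 + Υ) * N ^ (S - b - s₀) := by
      have := le_mul_of_one_le_right hΥ hNt
      rw [add_mul, one_mul]
      linarith
    have h3 : (N ^ (2 : ℝ) / 4) ^ (s₀ - (S - b)) =
        4 ^ (S - b - s₀) * N ^ (-(2 * (S - b - s₀))) := by
      rw [Real.div_rpow (by positivity) (by norm_num), ← Real.rpow_mul hN0.le, div_eq_mul_inv,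
        ← Real.rpow_neg (by norm_num), mul_comm]
      congr 2 <;> ring
    calc _ ≤ 4 ^ (S - b - s₀) * N ^ (-(2 * (S - b - s₀))) *
          (c₁ * (N ^ e * ((1 + Υ) * N ^ (S - b - s₀)))) := by
          rw [h3]
          refine mul_le_mul_of_nonneg_left (h1.trans ?_) (by positivity)
          exact mul_le_mul_of_nonneg_left (mul_le_mul_of_nonneg_left h2 (by positivity))
            (by linarith)
      _ = c₁ * (1 + Υ) * 4 ^ (S - b - s₀) *
          (N ^ (-(2 * (S - b - s₀))) * N ^ e * N ^ (S - b - s₀)) := by ring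
      _ = c₁ * (1 + Υ) * 4 ^ (S - b - s₀) * N ^ (e - (S - b - s₀)) := by
          rw [← Real.rpow_add hN0, ← Real.rpow_add hN0]
          congr 2; ring
      _ ≤ ρ := by
          refine mul_le_mul_of_nonneg_right ?_ (by positivity)
          refine mul_le_mul_of_nonneg_left ?_ (by positivity)
          exact Real.rpow_le_rpow_of_exponent_le (by norm_num) (by linarith)
  have hmem : ∀ x : {n // n ∈ A}, x.1 ∉ badSites K₀ s₀ S τ₂ δ Θ N M →
      IsGoodSite K₀ s₀ S τ₂ δ Θ N M x := by
    intro x hx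
    by_contra hg
    unfold badSites at hx
    exact hx (Finset.mem_filter.2 ⟨x.2, x.2, hg⟩)
  obtain ⟨V, R, hVP, hRc, hRs, hRP, hV⟩ := exists_cluster_left_inverse hν hs₀ hK₀ hC₁ hN hB
    (fun x hx => if_pos (hmem x hx)) (fun x => by split_ifs <;> simp) hP hPl hMT
    (by linarith : s₀ ≤ S - b) hfar hTρ
  have hVs : ∀ t ∈ Set.Icc s₀ s₂, sNorm K₀ t V ≤ c₂ * (a * N ^ (C₁ * (t - s₀))) := by
    intro t ht
    have htn : 0 ≤ t := hs₀n.trans ht.1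
    refine (hV t htn).trans ?_
    have h1 : (2 * N ^ C₁) ^ (t + b) =
        2 ^ (t + b) * (N ^ (C₁ * (s₀ + b)) * N ^ (C₁ * (t - s₀))) := by
      rw [Real.mul_rpow (by norm_num) (by positivity), ← Real.rpow_mul hN0.le,
        ← Real.rpow_add hN0]
      congr 2; ring
    calc _ = C₀ * (2 * 2 ^ (t + b)) * (a * N ^ (C₁ * (t - s₀))) := by rw [← hb, h1, ha]; ring
      _ ≤ _ := by
          rw [hc₂]
          refine mul_le_mul_of_nonneg_right (mul_le_mul_of_nonneg_left
            (mul_le_mul_of_nonneg_left ?_ zero_le_two) hC₀n) (by positivity)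
          exact Real.rpow_le_rpow_of_exponent_le (by norm_num) (by linarith [ht.2])
  have hVs₀ : sNorm K₀ s₀ V ≤ c₂ * a := by
    have := hVs s₀ ⟨le_rfl, by linarith⟩
    rwa [sub_self, mul_zero, Real.rpow_zero, mul_one] at this
  have hVR : κ * sNorm K₀ s₀ (V * R) ≤ 1 / 2 := by
    refine le_trans ?_ hm
    calc _ ≤ κ * (κ * sNorm K₀ s₀ V * sNorm K₀ s₀ R) :=
          mul_le_mul_of_nonneg_left (hT0.mul_le _ _) (by linarith)
      _ ≤ κ * (κ * (c₂ * a) * ρ) := by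
          refine mul_le_mul_of_nonneg_left ?_ (by linarith)
          exact mul_le_mul (mul_le_mul_of_nonneg_left hVs₀ (by linarith)) hRs (sNorm_nonneg _ _ _)
            (by positivity)
      _ = _ := by ring
  obtain ⟨J, hJ1, -, hJ3⟩ := hT0.exists_inverse hVR
  -- `V * P = πB + V * R = (1 + V * R) * πB`, and `J` inverts the first factor.
  have hYP : J * V * P = badProj K₀ s₀ S τ₂ δ Θ N M := by
    have h1 : V * P = (1 + V * R) * badProj K₀ s₀ S τ₂ δ Θ N M := by
      have h2 : V * P = V * (P - R) + V * R := by rw [← mul_add, sub_add_cancel]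
      rw [h2, hVP, add_mul, one_mul, mul_assoc V R]
      congr 2
      exact hRc.symm
    rw [mul_assoc, h1, ← mul_assoc, hJ1, one_mul]
  rw [hinv _ hYP]
  set g := N ^ (C₁ * (s - s₀)) + sNorm K₀ (s + b) Q with hg
  have hss : 0 ≤ s - s₀ := by linarith [hs.1]
  have hNg : N ^ (s - s₀) ≤ N ^ (C₁ * (s - s₀)) :=
    Real.rpow_le_rpow_of_exponent_le hN (le_mul_of_one_le_left hss (by linarith))
  have hgg : N ^ (s - s₀) + sNorm K₀ (s + b) Q ≤ g := by linarith
  have hg1 : 1 ≤ g := by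
    have : 1 ≤ N ^ (C₁ * (s - s₀)) := Real.one_le_rpow hN (by positivity)
    linarith [hQn (s + b)]
  have hc12 : c₁ ≤ c₁ + c₂ := by linarith
  have hup : ∀ {x y : ℝ}, 0 ≤ y → x ≤ c₁ * (y * (N ^ (s - s₀) + sNorm K₀ (s + b) Q)) →
      x ≤ (c₁ + c₂) * (y * g) := by
    intro x y hy hx
    refine hx.trans (mul_le_mul hc12 (mul_le_mul_of_nonneg_left hgg hy) ?_ (by linarith))
    have : 0 ≤ N ^ (s - s₀) := by positivity
    exact mul_nonneg hy (by linarith [hQn (s + b)])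
  obtain ⟨n1, n2, n3, n4⟩ := hbd s hs _ rfl
  refine (hT s ⟨hs.1, by linarith [hs.2]⟩).inverse_bound (by linarith : 1 ≤ c₁ + c₂) ha1 hE hg1
    (hJ3 V) hVR ?_ ?_ (hRs.trans hρ1) (hup (by positivity) ((hRP s).trans n2))
    (hNs.trans hc12) (hup (by positivity) n1) (hup (by positivity) n3) ?_ (hup (by positivity) n4)
  · exact hVs₀.trans (mul_le_mul_of_nonneg_right (by linarith) (by linarith))
  · refine (hVs s hs).trans (mul_le_mul (by linarith) (mul_le_mul_of_nonneg_left ?_ (by linarith))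
      (by positivity) (by linarith))
    linarith [hQn (s + b)]
  · exact hSs.trans (mul_le_mul_of_nonneg_right hc12 (by linarith))

theorem eventually_mul_rpow_le (C : ℝ) {x ε : ℝ} (hx : x < 0) (hε : 0 < ε) :
    ∀ᶠ N : ℝ in Filter.atTop, C * N ^ x ≤ ε := by
  have h := (tendsto_rpow_neg_atTop (neg_pos.2 hx)).const_mul C
  rw [mul_zero, neg_neg] at h
  exact (h.eventually_lt_const hε).mono fun N hN => hN.le

end Multiscale

/-! ### Choice of the constants and conclusion -/

open Multiscale in
theorem proposition3p1
    (ν d r : ℕ) (hν : 1 ≤ ν) (hr : 1 ≤ r) (hrd : r ≤ d)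
    -- the block sizes `𝔡_j`
    (dim : (Fin r → ℕ) → ℕ) (hdim : ∀ j, 1 ≤ dim j)
    (s₀ : ℝ) (hs₀ : ((ν : ℝ) + d) / 2 < s₀)
    (K₀ : ℝ) (hK₀ : 4 * ∑' k : LatticePt ν r, bracket k ^ (-(2 * s₀)) < K₀)
    (ϱ : ℝ) (hϱ : ϱ = (2 * (ν : ℝ) + d + r + 1) / 2)
    (δ τ τ₂ C₁ χ₀ s₁ e : ℝ) (he : e = τ₂ + ν + r + s₀)
    (hδ : δ ∈ Set.Ioo (0 : ℝ) (1 / 2)) (hτ : 0 < τ) (hτ₂ : 2 * τ + ν + r + 1 < τ₂) (hC₁ : 2 ≤ C₁)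
    (hχ₀ : 3 * (e + C₁ * (s₀ + ν + r)) < χ₀ * (τ₂ - 2 * τ - ν - r))
    (hχ₀δ : C₁ < χ₀ * δ)
    (hs₁ : 3 * e + 2 * χ₀ * (τ + ν + r) + C₁ * s₀ < s₁ - ϱ)
    (Υ : ℝ) (hΥ : 0 < Υ) :
    ∃ Θ₀ : ℝ, 0 < Θ₀ ∧ ∀ Θ : ℝ, Θ₀ ≤ Θ → ∀ s₂ : ℝ, s₁ - ϱ ≤ s₂ →
      ∃ Nbar : ℕ, ∀ N : ℝ, (Nbar : ℝ) ≤ N → ∀ χ ∈ Set.Icc χ₀ (2 * χ₀), ∀ N' : ℝ, N' = N ^ χ →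
        ∀ A : Finset (Site ν r), DiamLE A (4 * N') →
        ∀ M : BlockMat dim A A, HasScalarDiag M →
          sNorm K₀ (s₁ - ϱ) (M - blockDiag M) ≤ Υ →
          (IsUnit M ∧ opNorm M⁻¹ ≤ N' ^ τ) →
          HasSeparatedPartition (badSites K₀ s₀ (s₁ - ϱ) τ₂ δ Θ N M) (N ^ C₁) (N ^ (2 : ℝ)) →
          IsGoodMatrix K₀ s₀ (s₁ - ϱ) τ₂ δ N' M ∧
            ∀ s ∈ Set.Icc s₀ s₂,
              sNorm K₀ s M⁻¹ ≤
                1 / 4 * N' ^ τ₂ * (N' ^ (δ * s) + sNorm K₀ s (M - blockDiag M)) := by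
  generalize s₁ - ϱ = S at *
  set b : ℝ := (ν : ℝ) + r with hb
  have hν1 : (1 : ℝ) ≤ ν := by exact_mod_cast hν
  have hr1 : (1 : ℝ) ≤ r := by exact_mod_cast hr
  have hrd' : (r : ℝ) ≤ d := by exact_mod_cast hrd
  have hb2 : 2 ≤ b := by linarith
  have hs₀' : (ν : ℝ) + r < 2 * s₀ := by linarith
  have hs₀1 : 1 < s₀ := by linarith
  have he' : e = τ₂ + (ν + r) + s₀ := by rw [he]; ring
  have heb : e = τ₂ + b + s₀ := he'
  obtain ⟨hδ0, hδ2⟩ := hδ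
  have hτ₂b : 2 * τ + b + 1 < τ₂ := by linarith
  have hτ₂0 : 0 ≤ τ₂ := by linarith
  have he0 : 0 < e := by linarith
  have hχ0 : 0 < χ₀ := by
    by_contra h
    linarith [mul_nonpos_of_nonpos_of_nonneg (not_lt.1 h) hδ0.le]
  have hχC : 2 * C₁ < χ₀ := by linarith [mul_le_mul_of_nonneg_left hδ2.le hχ0.le]
  have hs₁' : 3 * e + 2 * χ₀ * (τ + b) + C₁ * s₀ < S := by
    have : τ + b = τ + ν + r := by rw [hb]; ring
    rw [this]; exact hs₁
  have hχ₀' : 3 * (e + C₁ * (s₀ + b)) < χ₀ * (τ₂ - 2 * τ - b) := by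
    have h1 : s₀ + b = s₀ + ν + r := by rw [hb]; ring
    have h2 : τ₂ - 2 * τ - b = τ₂ - 2 * τ - ν - r := by rw [hb]; ring
    rw [h1, h2]; exact hχ₀
  have hp1 : 0 ≤ χ₀ * (τ + b) := by positivity
  have hp2 : 0 ≤ C₁ * s₀ := by positivity
  have hS3 : 3 * e < S := by linarith
  have hSb : s₀ + b ≤ S := by linarith
  have hK4 := four_lt_of_tsum_lt hs₀' hK₀
  obtain ⟨C₀, hC₀⟩ : ∃ x, x = decayConst ν r K₀ := ⟨_, rfl⟩
  have hC₀n : 0 ≤ C₀ := hC₀ ▸ decayConst_nonneg K₀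
  obtain ⟨κ, hκ1, hκ⟩ := exists_tamePair_sNorm (dim := dim) hs₀' hK₀
  -- This makes `κ * C₀ * Υ / Θ ≤ 1 / 4`, half of the Neumann budget for `Γ`; neither `κ` nor `C₀`
  -- depends on `s₂`. The other half comes from `N` large.
  refine ⟨1 + 4 * (κ * (C₀ * Υ)), by positivity, fun Θ hΘ s₂ hs₂ => ?_⟩
  have hΘ1 : 1 ≤ Θ := by
    have : 0 ≤ κ * (C₀ * Υ) := by positivity
    linarith
  have hΘ0 : 0 < Θ := by linarith
  obtain ⟨K, hκK, hT⟩ := hκ (s₂ + b)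
  have hK1 : 1 ≤ K := hκ1.trans hκK
  obtain ⟨c, hc⟩ : ∃ x, x = 4 ^ (s₂ + b) * (2 * (K * (1 + Υ))) := ⟨_, rfl⟩
  obtain ⟨c₁, hc₁⟩ : ∃ x, x = 20 * K ^ 4 * (1 + Υ + C₀ * (Θ + c)) ^ 5 := ⟨_, rfl⟩
  obtain ⟨c₂, hc₂⟩ : ∃ x, x = C₀ * (2 * 2 ^ (s₂ + b)) := ⟨_, rfl⟩
  have hc0 : 0 ≤ c := by rw [hc]; positivity
  have hc₁0 : 0 ≤ c₁ := by rw [hc₁]; positivity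
  have hc₂0 : 0 ≤ c₂ := by rw [hc₂]; positivity
  obtain ⟨Cf, hCf⟩ : ∃ x, x = 20 * K ^ 4 * (c₁ + c₂) ^ 5 := ⟨_, rfl⟩
  have hCf0 : 0 ≤ Cf := by rw [hCf]; positivity
  -- the conditions on `N`
  have hx1 : e - (1 - δ) * S < 0 := by
    have : 1 / 2 * S ≤ (1 - δ) * S := mul_le_mul_of_nonneg_right (by linarith) (by linarith)
    linarith
  -- This exponent governs the smallness of `R` against its left inverse. The lower bound on `S`
  -- enters here, with `b + s₀ ≤ e` and `C₁ * b ≤ 2 * χ₀ * b`.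
  have hx2 : 2 * χ₀ * τ + C₁ * (s₀ + b) + (e - (S - b - s₀)) < 0 := by
    have : C₁ * b ≤ 2 * χ₀ * b := mul_le_mul_of_nonneg_right (by linarith) (by linarith)
    linarith
  have hx3 : -(e + C₁ * (s₀ + b)) < 0 := by
    have : 0 ≤ C₁ * (s₀ + b) := by positivity
    linarith
  -- In order: the Neumann inversion for `Γ`, both inversions on the bad sites, and the absorption
  -- of the final constant into the factor `1 / 4`.
  have hev := ((eventually_mul_rpow_le (κ * (C₀ * c)) hx1 (by norm_num : (0 : ℝ) < 1 / 4)).and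
    ((eventually_mul_rpow_le ((1 + κ * (κ * c₂)) * (c₁ * (1 + Υ) * 4 ^ s₂)) hx2
      (by norm_num : (0 : ℝ) < 1 / 2)).and
    ((eventually_mul_rpow_le (Cf * 4 ^ b) hx3
      (by norm_num : (0 : ℝ) < 1 / 4)).and
    ((Filter.eventually_ge_atTop (1 : ℝ)).and (Filter.eventually_ge_atTop Υ)))))
  obtain ⟨N₀, hN₀⟩ := Filter.eventually_atTop.1 hev
  obtain ⟨Nbar, hNbar⟩ := exists_nat_ge N₀
  refine ⟨Nbar, fun N hN χ hχ N' hN' A hA M hdiag hQ hM hB => ?_⟩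
  obtain ⟨e1, e2, e3, hN1, hNΥ⟩ := hN₀ N (hNbar.trans hN)
  have hN0 : 0 < N := by linarith
  have hχ0' : 0 < χ := hχ0.trans_le hχ.1
  have hN'1 : 1 ≤ N' := hN' ▸ Real.one_le_rpow hN1 hχ0'.le
  have hN'0 : 0 < N' := by linarith
  have hN'p : ∀ t : ℝ, N' ^ t = N ^ (χ * t) := fun t => by rw [hN', ← Real.rpow_mul hN0.le]
  have hC₁χ : C₁ ≤ χ * δ := by linarith [mul_le_mul_of_nonneg_right hχ.1 hδ0.le]
  set Q := M - blockDiag M with hQd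
  have hQn : ∀ s, 0 ≤ sNorm K₀ s Q := fun s => sNorm_nonneg _ _ _
  have hsmall : κ * (C₀ * (Υ / Θ + c * N ^ (e - (1 - δ) * S))) ≤ 1 / 2 := by
    have h1 : κ * (C₀ * Υ) / Θ ≤ 1 / 4 := by
      rw [div_le_iff₀ hΘ0]; linarith
    calc _ = κ * (C₀ * Υ) / Θ + κ * (C₀ * c) * N ^ (e - (1 - δ) * S) := by ring
      _ ≤ _ := by linarith
  have hsmall' : (1 + κ * (κ * c₂)) * (N' ^ τ * N ^ (C₁ * (s₀ + b)) *
      (c₁ * (1 + Υ) * 4 ^ s₂ * N ^ (e - (S - b - s₀)))) ≤ 1 / 2 := by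
    refine le_trans ?_ e2
    have h1 : N' ^ τ ≤ N ^ (2 * χ₀ * τ) := by
      rw [hN'p]
      exact Real.rpow_le_rpow_of_exponent_le hN1 (mul_le_mul_of_nonneg_right hχ.2 hτ.le)
    calc _ = (1 + κ * (κ * c₂)) * (c₁ * (1 + Υ) * 4 ^ s₂) *
          (N' ^ τ * (N ^ (C₁ * (s₀ + b)) * N ^ (e - (S - b - s₀)))) := by ring
      _ ≤ (1 + κ * (κ * c₂)) * (c₁ * (1 + Υ) * 4 ^ s₂) *
          (N ^ (2 * χ₀ * τ) * (N ^ (C₁ * (s₀ + b)) * N ^ (e - (S - b - s₀)))) :=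
          mul_le_mul_of_nonneg_left (mul_le_mul_of_nonneg_right h1 (by positivity))
            (by positivity)
      _ = _ := by rw [← Real.rpow_add hN0, ← Real.rpow_add hN0, add_assoc]
  have hmain : ∀ s ∈ Set.Icc s₀ s₂,
      sNorm K₀ s M⁻¹ ≤ 1 / 4 * N' ^ τ₂ * (N' ^ (δ * s) + sNorm K₀ s Q) := by
    intro s hs
    have hs0 : 0 ≤ s := by linarith [hs.1]
    refine (sNorm_inv_le hν hs₀' hK₀ hSb hs₂ (by linarith) hτ₂0 he' hΘ1 hN1 hΥ.le hC₁
      (fun t ht => hT t ht A) hc.ge (hC₀ ▸ hsmall) (hC₀ ▸ hc₁) (hC₀ ▸ hc₂) hM.1 hdiag hQ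
      (Real.one_le_rpow hN'1 hτ.le) hM.2 hsmall' hB hs).trans ?_
    rw [← hCf]
    -- The extra `b` derivatives on `Q` cost only `(4 * N') ^ b`, because `A` has diameter at most
    -- `4 * N'`.
    have hq : sNorm K₀ (s + b) Q ≤ 4 ^ b * N' ^ b * sNorm K₀ s Q := by
      have h := sNorm_le_of_near (K₀ := K₀) (by linarith) (s := s) (s' := s + b) (by linarith)
        (by linarith : 0 ≤ 4 * N') (M := Q)
        fun u v _ => bracket_le_of_siteDist_le (by linarith) (hA u.1 u.2 v.1 v.2)
      rwa [add_sub_cancel_left, Real.mul_rpow (by norm_num) hN'0.le] at h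
    -- Growth at the scale of the clusters is admissible at the scale `N'` because `C₁ ≤ χ * δ`.
    have hNδ : N ^ (C₁ * (s - s₀)) ≤ N' ^ (δ * s) := by
      rw [hN'p]
      refine Real.rpow_le_rpow_of_exponent_le hN1 ?_
      linarith [mul_le_mul_of_nonneg_right hC₁χ hs0]
    have h4b : 1 ≤ (4 : ℝ) ^ b * N' ^ b := one_le_mul_of_one_le_of_one_le
      (Real.one_le_rpow (by norm_num) (by linarith)) (Real.one_le_rpow hN'1 (by linarith))
    have hg : N ^ (C₁ * (s - s₀)) + sNorm K₀ (s + b) Q ≤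
        4 ^ b * N' ^ b * (N' ^ (δ * s) + sNorm K₀ s Q) := by
      have : N' ^ (δ * s) ≤ 4 ^ b * N' ^ b * N' ^ (δ * s) :=
        le_mul_of_one_le_left (by positivity) h4b
      rw [mul_add]
      linarith
    have hgn : 0 ≤ N' ^ (δ * s) + sNorm K₀ s Q := add_nonneg (by positivity) (hQn s)
    -- The losses use two of the three copies of `e + C₁ * (s₀ + b)` in the hypothesis on `χ₀`; the
    -- third survives as a negative power that beats the constants.
    have hpow : (N' ^ τ * N ^ (C₁ * (s₀ + b))) ^ 2 * (N ^ e) ^ 2 * N' ^ b ≤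
        N ^ (-(e + C₁ * (s₀ + b))) * N' ^ τ₂ := by
      rw [hN'p, hN'p, hN'p, ← Real.rpow_add hN0, ← Real.rpow_natCast, ← Real.rpow_natCast,
        ← Real.rpow_mul hN0.le, ← Real.rpow_mul hN0.le, ← Real.rpow_add hN0, ← Real.rpow_add hN0,
        ← Real.rpow_add hN0]
      refine Real.rpow_le_rpow_of_exponent_le hN1 ?_
      have h1 : χ₀ * (τ₂ - 2 * τ - b) ≤ χ * (τ₂ - 2 * τ - b) :=
        mul_le_mul_of_nonneg_right hχ.1 (by linarith)
      push_cast
      linarith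
    calc _ ≤ Cf * ((N' ^ τ * N ^ (C₁ * (s₀ + b))) ^ 2 * (N ^ e) ^ 2 *
          (4 ^ b * N' ^ b * (N' ^ (δ * s) + sNorm K₀ s Q))) :=
          mul_le_mul_of_nonneg_left (mul_le_mul_of_nonneg_left hg (by positivity)) hCf0
      _ = Cf * 4 ^ b * ((N' ^ τ * N ^ (C₁ * (s₀ + b))) ^ 2 * (N ^ e) ^ 2 * N' ^ b) *
          (N' ^ (δ * s) + sNorm K₀ s Q) := by ring
      _ ≤ Cf * 4 ^ b * (N ^ (-(e + C₁ * (s₀ + b))) * N' ^ τ₂) *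
          (N' ^ (δ * s) + sNorm K₀ s Q) :=
          mul_le_mul_of_nonneg_right (mul_le_mul_of_nonneg_left hpow (by positivity)) hgn
      _ = Cf * 4 ^ b * N ^ (-(e + C₁ * (s₀ + b))) * N' ^ τ₂ *
          (N' ^ (δ * s) + sNorm K₀ s Q) := by ring
      _ ≤ _ := mul_le_mul_of_nonneg_right (mul_le_mul_of_nonneg_right e3 (by positivity)) hgn
  refine ⟨⟨hA, hM.1, fun s hs => (hmain s ⟨hs.1, hs.2.trans hs₂⟩).trans ?_⟩, hmain⟩
  have hqs : sNorm K₀ s Q ≤ Υ := (sNorm_mono_exponent (by linarith) hs.2 Q).trans hQ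
  -- `χ * δ * s ≥ C₁ * s ≥ 2`. With `Υ ≤ N` this lets `N' ^ (δ * s)` absorb `Q`.
  have hNδ : N ≤ N' ^ (δ * s) := by
    rw [hN'p]
    nth_rw 1 [← Real.rpow_one N]
    refine Real.rpow_le_rpow_of_exponent_le hN1 ?_
    have hs1 : 1 ≤ s := by linarith [hs.1]
    linarith [mul_le_mul_of_nonneg_right hC₁χ (by linarith : 0 ≤ s),
      mul_le_mul hC₁ hs1 zero_le_one (by linarith)]
  have hsum : N' ^ (δ * s) + sNorm K₀ s Q ≤ 4 * N' ^ (δ * s) := by linarith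
  calc _ ≤ 1 / 4 * N' ^ τ₂ * (4 * N' ^ (δ * s)) :=
        mul_le_mul_of_nonneg_left hsum (by positivity)
    _ = N' ^ τ₂ * N' ^ (δ * s) := by ring
    _ = _ := by rw [← Real.rpow_add hN'0]
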